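/- Let $M$ be a smooth (finite-dimensional, Hausdorff) manifold and let $\mathcal A\to M$ be a transitive Lie algebroid of finite rank, i.e. a smooth real vector bundle with a surjective smooth linear bundle map (anchor) $\Pi:\mathcal A\to TM$ over the identity and an $\mathbb R$-bilinear skew bracket $[\![\cdot,\cdot]\!]$ on the space $\Gamma(\mathcal A)$ of smooth sections that satisfies the Jacobi identity, $[\![\sigma,f\tau]\!]=f[\![\sigma,\tau]\!]+\Pi(\sigma)(f)\,\tau$ for $f\in C^\infty(M)$, and $\Pi([\![\sigma,\tau]\!])=[\Pi(\sigma),\Pi(\tau)]$. Let $D$ be a self-representation of $\mathcal A$ that extends the canonical representation on the kernel (so that $(\mathcal A,D)$ is a transitive Cartan algebroid): to each $\sigma\in\Gamma(\mathcal A)$ it assigns an operator $D_\sigma$ on $\Gamma(\mathcal A)$ such that $D_\sigma\tau$ is $\mathbb R$-linear in $\sigma$ and in $\tau$, $D_{f\sigma}\tau=fD_\sigma\tau$, $D_\sigma(f\tau)=fD_\sigma\tau+\Pi(\sigma)(f)\,\tau$ for $f\in C^\infty(M)$, $D_{[\![\sigma,\tau]\!]}=D_\sigma D_\tau-D_\tau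 D_\sigma$, and $D_\sigma s=[\![\sigma,s]\!]$ for every $s\in\Gamma(\ker\mathcal A)$, that is, for every section $s$ with $\Pi(s)=0$. Let $$T(\sigma,\tau)=D_\sigma\tau-D_\tau\sigma-[\![\sigma,\tau]\!]$$ be the torsion of $D$, and suppose that $\mathcal A$ is locally symmetric, i.e. $DT=0$: $$D_\rho\bigl(T(\sigma,\tau)\bigr)-T(D_\rho\sigma,\tau)-T(\sigma,D_\rho\tau)=0\qquad(\rho,\sigma,\tau\in\Gamma(\mathcal A)).$$ Set $\{\sigma,\tau\}=-T(\sigma,\tau)$. Then $\{\cdot,\cdot\}$ is a Lie-algebraic bracket on $\Gamma(\mathcal A)$, i.e. it is $C^\infty(M)$-bilinear, skew and satisfies the Jacobi identity, and 1. $\mathcal A$ is a Lie algebra bundle whose Lie-algebraic bracket is $\{\cdot,\cdot\}$: each fibre $\mathcal A_x$ carries a Lie algebra bracket $\{\cdot,\cdot\}_x$ with $\{\sigma,\tau\}(x)=\{\sigma(x),\tau(x)\}_x$ for all sections $\sigma,\tau$, and over each connected component of $M$ there is one Lie algebra $\mathfrak g$ such that around every point of the component $\mathcal A$ has a smooth local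 trivialization $\mathcal A|_U\cong U\times\mathfrak g$ which is a Lie algebra isomorphism on every fibre; 2. $[\![s,t]\!]=-\{s,t\}$ for all $s,t\in\Gamma(\ker\mathcal A)$; 3. each $D_\rho$ is a derivation of the bracket, $D_\rho\{\sigma,\tau\}=\{D_\rho\sigma,\tau\}+\{\sigma,D_\rho\tau\}$, and $D_s\tau=-\{s,\tau\}$ for all $s\in\Gamma(\ker\mathcal A)$ and $\tau\in\Gamma(\mathcal A)$. -/

import Mathlib

open Bundle
open scoped Manifold ContDiff

noncomputable section

/-- `b` is a Lie-algebraic bracket over the commutative ring `R`: it is `R`-bilinear, alternating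
and satisfies the Jacobi identity. It is used both for real Lie algebra structures on a vector space
(`R = ℝ`) and for brackets of sections over the ring of smooth functions. -/
structure IsLieAlgebraicBracket (R : Type*) {N : Type*} [CommRing R] [AddCommGroup N] [Module R N]
    (b : N → N → N) : Prop where
  add_left : ∀ x y z, b (x + y) z = b x z + b y z
  add_right : ∀ x y z, b x (y + z) = b x y + b x z
  smul_left : ∀ (r : R) (x y), b (r • x) y = r • b x y
  smul_right : ∀ (r : R) (x y), b x (r • y) = r • b x y
  self : ∀ x, b x x = 0
  jacobi : ∀ x y z, b x (b y z) + b y (b z x) + b z (b x y) = 0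

namespace ContMDiffSection

variable {E : Type*} [NormedAddCommGroup E] [NormedSpace ℝ E]
  {M : Type*} [TopologicalSpace M] [ChartedSpace E M]
  {F : Type*} [NormedAddCommGroup F] [NormedSpace ℝ F]
  {V : M → Type*} [TopologicalSpace (TotalSpace F V)] [∀ x, TopologicalSpace (V x)]
  [∀ x, AddCommGroup (V x)] [∀ x, Module ℝ (V x)] [FiberBundle F V] [VectorBundle ℝ F V]

/-- The pointwise product of a smooth function and a smooth section. -/
instance instSMulSmoothFunction :
    SMul C^∞⟮𝓘(ℝ, E), M; 𝓘(ℝ, ℝ), ℝ⟯ Cₛ^∞⟮𝓘(ℝ, E); F, V⟯ :=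
  ⟨fun f σ => ⟨fun x => f x • σ x, f.contMDiff.smul_section σ.contMDiff⟩⟩

theorem smoothFunction_smul_apply (f : C^∞⟮𝓘(ℝ, E), M; 𝓘(ℝ, ℝ), ℝ⟯)
    (σ : Cₛ^∞⟮𝓘(ℝ, E); F, V⟯) (x : M) : (f • σ) x = f x • σ x := rfl

/-- The smooth sections of a vector bundle form a module over the ring of smooth functions. -/
instance instModuleSmoothFunction :
    Module C^∞⟮𝓘(ℝ, E), M; 𝓘(ℝ, ℝ), ℝ⟯ Cₛ^∞⟮𝓘(ℝ, E); F, V⟯ where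
  one_smul σ := by ext x; exact one_smul ℝ (σ x)
  mul_smul f g σ := by ext x; exact mul_smul (f x) (g x) (σ x)
  smul_zero f := by ext x; exact smul_zero (f x)
  smul_add f σ τ := by ext x; exact smul_add (f x) (σ x) (τ x)
  add_smul f g σ := by ext x; exact add_smul (f x) (g x) (σ x)
  zero_smul σ := by ext x; exact zero_smul ℝ (σ x)

end ContMDiffSection

section Algebroids

variable {E : Type*} [NormedAddCommGroup E] [NormedSpace ℝ E]
  {M : Type*} [TopologicalSpace M] [ChartedSpace E M]

/-- The derivative at `x` of a smooth function `f` in the direction of the tangent vector `u`. -/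
def directionalDeriv (f : C^∞⟮𝓘(ℝ, E), M; 𝓘(ℝ, ℝ), ℝ⟯) (x : M)
    (u : TangentSpace 𝓘(ℝ, E) x) : ℝ :=
  mfderiv 𝓘(ℝ, E) 𝓘(ℝ, ℝ) f x u

variable (E) (F : Type*) [NormedAddCommGroup F] [NormedSpace ℝ F]
  (V : M → Type*) [TopologicalSpace (TotalSpace F V)] [∀ x, TopologicalSpace (V x)]
  [∀ x, AddCommGroup (V x)] [∀ x, Module ℝ (V x)] [FiberBundle F V] [VectorBundle ℝ F V]

/-- A Lie algebroid structure on the smooth vector bundle `V → M` with model fibre `F`, where the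
smooth manifold `M` is modelled on `E`. -/
structure LieAlgebroid [IsManifold 𝓘(ℝ, E) ∞ M] where
  /-- the anchor `Π`, a smooth linear bundle map `V → TM` over the identity -/
  anchor : ∀ x : M, V x →ₗ[ℝ] TangentSpace 𝓘(ℝ, E) x
  contMDiff_anchor : ContMDiff (𝓘(ℝ, E).prod 𝓘(ℝ, F)) 𝓘(ℝ, E).tangent ∞
    (fun p : TotalSpace F V => (⟨p.1, anchor p.1 p.2⟩ : TangentBundle 𝓘(ℝ, E) M))
  /-- the `ℝ`-bilinear bracket `⟦σ, τ⟧` of smooth sections -/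
  bracket : Cₛ^∞⟮𝓘(ℝ, E); F, V⟯ →ₗ[ℝ] Cₛ^∞⟮𝓘(ℝ, E); F, V⟯ →ₗ[ℝ] Cₛ^∞⟮𝓘(ℝ, E); F, V⟯
  bracket_skew : ∀ σ τ, bracket σ τ = -bracket τ σ
  bracket_leibniz : ∀ (σ τ : Cₛ^∞⟮𝓘(ℝ, E); F, V⟯) (f : C^∞⟮𝓘(ℝ, E), M; 𝓘(ℝ, ℝ), ℝ⟯) (x : M),
    bracket σ (f • τ) x = f x • bracket σ τ x + directionalDeriv f x (anchor x (σ x)) • τ x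
  jacobi : ∀ ρ σ τ, bracket ρ (bracket σ τ) + bracket σ (bracket τ ρ) + bracket τ (bracket ρ σ) = 0
  anchor_bracket : ∀ (σ τ : Cₛ^∞⟮𝓘(ℝ, E); F, V⟯) (x : M),
    anchor x (bracket σ τ x) =
      VectorField.mlieBracket 𝓘(ℝ, E) (fun y => anchor y (σ y)) (fun y => anchor y (τ y)) x

/-- The fibrewise bracket `br` makes the smooth vector bundle `V → M` a Lie algebra bundle: every
fibre is a real Lie algebra and, over each connected component of `M`, there is one Lie algebra
structure `b` on the model fibre `F` such that `V` has, around every point of the component, a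
smooth local trivialization `φ : V|_U ≃ U × F` that is a Lie algebra isomorphism on each fibre.
(When `M` is connected this is the usual notion, with a single model Lie algebra.) -/
structure IsLieAlgebraBundle (br : ∀ x : M, V x → V x → V x) : Prop where
  fibre : ∀ x, IsLieAlgebraicBracket ℝ (br x)
  locally_trivial : ∀ x₀ : M, ∃ b : F → F → F, IsLieAlgebraicBracket ℝ b ∧
    ∀ x ∈ connectedComponent x₀, ∃ (U : Set M) (φ : ∀ y : M, V y ≃ₗ[ℝ] F),
      IsOpen U ∧ x ∈ U ∧
      ContMDiffOn (𝓘(ℝ, E).prod 𝓘(ℝ, F)) 𝓘(ℝ, F) ∞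
        (fun p : TotalSpace F V => φ p.1 p.2) (TotalSpace.proj ⁻¹' U) ∧
      ContMDiffOn (𝓘(ℝ, E).prod 𝓘(ℝ, F)) (𝓘(ℝ, E).prod 𝓘(ℝ, F)) ∞
        (fun q : M × F => (⟨q.1, (φ q.1).symm q.2⟩ : TotalSpace F V)) (U ×ˢ Set.univ) ∧
      ∀ y ∈ U, ∀ v w : V y, φ y (br y v w) = b (φ y v) (φ y w)

namespace LieAlgebroid

variable {E F V} [IsManifold 𝓘(ℝ, E) ∞ M]

/-- The algebroid is transitive: its anchor is surjective (on every fibre). -/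
def IsTransitive (A : LieAlgebroid E F V) : Prop :=
  ∀ x, Function.Surjective (A.anchor x)

/-- The smooth section `s` takes values in the kernel of the anchor. -/
def IsKernelSection (A : LieAlgebroid E F V) (s : Cₛ^∞⟮𝓘(ℝ, E); F, V⟯) : Prop :=
  ∀ x, A.anchor x (s x) = 0

/-- An `A`-connection `D` of the Lie algebroid `A` on itself. -/
structure SelfConnection (A : LieAlgebroid E F V) where
  /-- `D σ τ` is `D_σ τ`; it is `ℝ`-linear in both arguments -/
  D : Cₛ^∞⟮𝓘(ℝ, E); F, V⟯ →ₗ[ℝ] Cₛ^∞⟮𝓘(ℝ, E); F, V⟯ →ₗ[ℝ] Cₛ^∞⟮𝓘(ℝ, E); F, V⟯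
  smul_left : ∀ (f : C^∞⟮𝓘(ℝ, E), M; 𝓘(ℝ, ℝ), ℝ⟯) (σ τ : Cₛ^∞⟮𝓘(ℝ, E); F, V⟯),
    D (f • σ) τ = f • D σ τ
  leibniz : ∀ (σ τ : Cₛ^∞⟮𝓘(ℝ, E); F, V⟯) (f : C^∞⟮𝓘(ℝ, E), M; 𝓘(ℝ, ℝ), ℝ⟯) (x : M),
    D σ (f • τ) x = f x • D σ τ x + directionalDeriv f x (A.anchor x (σ x)) • τ x

namespace SelfConnection

variable {A : LieAlgebroid E F V}

/-- The curvature `C(σ, τ)ρ = D_σ D_τ ρ - D_τ D_σ ρ - D_⟦σ, τ⟧ ρ`. -/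
def curvature (C : A.SelfConnection) (σ τ ρ : Cₛ^∞⟮𝓘(ℝ, E); F, V⟯) : Cₛ^∞⟮𝓘(ℝ, E); F, V⟯ :=
  C.D σ (C.D τ ρ) - C.D τ (C.D σ ρ) - C.D (A.bracket σ τ) ρ

/-- The connection is a representation of `A` on itself: its curvature vanishes. -/
def IsRepresentation (C : A.SelfConnection) : Prop :=
  ∀ σ τ ρ, C.curvature σ τ ρ = 0

/-- The connection extends the canonical representation `s ↦ ⟦σ, s⟧` of `A` on its kernel. -/
def ExtendsCanonical (C : A.SelfConnection) : Prop :=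
  ∀ σ s, A.IsKernelSection s → C.D σ s = A.bracket σ s

/-- The torsion `T(σ, τ) = D_σ τ - D_τ σ - ⟦σ, τ⟧`. -/
def torsion (C : A.SelfConnection) (σ τ : Cₛ^∞⟮𝓘(ℝ, E); F, V⟯) : Cₛ^∞⟮𝓘(ℝ, E); F, V⟯ :=
  C.D σ τ - C.D τ σ - A.bracket σ τ

/-- The covariant derivative `(D_ρ T)(σ, τ) = D_ρ (T(σ, τ)) - T(D_ρ σ, τ) - T(σ, D_ρ τ)`. -/
def derivTorsion (C : A.SelfConnection) (ρ σ τ : Cₛ^∞⟮𝓘(ℝ, E); F, V⟯) :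
    Cₛ^∞⟮𝓘(ℝ, E); F, V⟯ :=
  C.D ρ (C.torsion σ τ) - C.torsion (C.D ρ σ) τ - C.torsion σ (C.D ρ τ)

/-- Local symmetry: `DT = 0`. -/
def IsLocallySymmetric (C : A.SelfConnection) : Prop :=
  ∀ ρ σ τ, C.derivTorsion ρ σ τ = 0

/-- The bracket `{σ, τ} = -T(σ, τ)`. -/
def symBracket (C : A.SelfConnection) (σ τ : Cₛ^∞⟮𝓘(ℝ, E); F, V⟯) : Cₛ^∞⟮𝓘(ℝ, E); F, V⟯ :=
  -C.torsion σ τ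

end SelfConnection

end LieAlgebroid

end Algebroids

end

noncomputable section

open Set Filter Topology

theorem exists_slice_of_hasDerivAt {X G : Type*} [NormedAddCommGroup X] [NormedSpace ℝ X]
    [FiniteDimensional ℝ X] [NormedAddCommGroup G] [NormedSpace ℝ G] [FiniteDimensional ℝ G]
    {f : X × (G × X) → X} {x₀ : X} (T : G →ₗ[ℝ] X) (hfs : ContDiff ℝ ω f) (hf0 : f (x₀, 0) = 0)
    (hderiv : ∀ q : G × X, HasDerivAt (fun t : ℝ => f (x₀, t • q)) (T q.1 - q.2) 0) :
    ∃ (g : X → G) (w : X → X) (P : X →L[ℝ] X),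
      g x₀ = 0 ∧ w x₀ = 0 ∧ (∀ η, P (T η) = 0) ∧ (∀ x, P (w x) = w x) ∧
      ∀ᶠ x in 𝓝 x₀, ContDiffAt ℝ ω g x ∧ ContDiffAt ℝ ω w x ∧ f (x, (g x, w x)) = 0 := by
  obtain ⟨K, hK⟩ := Submodule.exists_isCompl (LinearMap.ker T)
  obtain ⟨W, hW⟩ := Submodule.exists_isCompl (LinearMap.range T)
  set ι : X × (K × W) →L[ℝ] X × (G × X) :=
    (ContinuousLinearMap.id ℝ X).prodMap (K.subtypeL.prodMap W.subtypeL) with hι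
  have hcd : ContDiffAt ℝ ω (f ∘ ι) (x₀, 0) := (hfs.comp ι.contDiff).contDiffAt
  have hd : ∀ q : K × W, fderiv ℝ (f ∘ ι) (x₀, 0) (0, q) = T q.1 - q.2 := by
    intro q
    have h1 : HasDerivAt (fun t : ℝ => (x₀, t • q)) (0, q) 0 := by
      refine (hasDerivAt_const (0 : ℝ) x₀).prodMk ?_
      simpa using (hasDerivAt_id (0:ℝ)).smul_const q
    have h2 : HasFDerivAt (f ∘ ι) (fderiv ℝ (f ∘ ι) (x₀, 0)) (x₀, (0 : ℝ) • q) := by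
      rw [zero_smul]
      exact (hcd.differentiableAt (by simp)).hasFDerivAt
    have h3 := h2.comp_hasDerivAt (0 : ℝ) h1
    exact h3.unique (hderiv (q.1, q.2))
  have hbij : Function.Bijective
      (fderiv ℝ (f ∘ ι) (x₀, 0) ∘L .inr ℝ X (K × W) : K × W →ₗ[ℝ] X) := by
    constructor
    · rw [← LinearMap.ker_eq_bot, LinearMap.ker_eq_bot']
      rintro ⟨k, w⟩ h
      have h' : T k - w = 0 := by simpa [hd] using h
      have h'' : T k = w := sub_eq_zero.1 h'
      have hw0 : (w : X) = 0 :=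
        (Submodule.disjoint_def.1 hW.disjoint) _ (h'' ▸ ⟨_, rfl⟩) w.2
      have hk0 : (k : G) = 0 :=
        (Submodule.disjoint_def.1 hK.disjoint) _ (by simp [h'', hw0]) k.2
      ext1 <;> ext1 <;> assumption
    · intro β
      obtain ⟨_, ⟨η, rfl⟩, w, hw, rfl⟩ := Submodule.mem_sup.1
        (hW.sup_eq_top ▸ Submodule.mem_top : β ∈ LinearMap.range T ⊔ W)
      obtain ⟨m, hm, k, hk, rfl⟩ := Submodule.mem_sup.1
        (hK.sup_eq_top ▸ Submodule.mem_top : η ∈ LinearMap.ker T ⊔ K)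
      refine ⟨(⟨k, hk⟩, -⟨w, hw⟩), ?_⟩
      have hm' : T m = 0 := hm
      simp [hd, hm']
  have hinv : (fderiv ℝ (f ∘ ι) (x₀, 0) ∘L .inr ℝ X (K × W)).IsInvertible :=
    ⟨(LinearEquiv.ofBijective _ hbij).toContinuousLinearEquiv, rfl⟩
  have hn : (ω : WithTop ℕ∞) ≠ 0 := by simp
  have hψ0 := hcd.implicitFunction_apply_self hn hinv
  have hψc := hcd.contDiffAt_implicitFunction hn hinv
  have hψe := hcd.eventually_apply_implicitFunction hn hinv
  set ψ := hcd.implicitFunction hn hinv with hψ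
  simp only at hψ0 hψc hψe
  refine ⟨fun b => (ψ b).1, fun b => (ψ b).2,
    LinearMap.toContinuousLinearMap (W.projection _ hW.symm), by simp [hψ0], by simp [hψ0], ?_, ?_,
    ?_⟩
  · intro η
    exact Submodule.projection_apply_of_mem_right hW.symm ⟨η, rfl⟩
  · intro b
    exact Submodule.projection_apply_left hW.symm _
  · filter_upwards [hψc.eventually (by simp), hψe] with b h1 h2
    refine ⟨K.subtypeL.contDiff.contDiffAt.comp _ h1.fst,
      W.subtypeL.contDiff.contDiffAt.comp _ h1.snd, ?_⟩
    rw [← hf0]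
    exact h2

/-- The space of (continuous) bilinear operations on a normed space. -/
def BilinearOperation (F : Type*) [NormedAddCommGroup F] [NormedSpace ℝ F] : Type _ :=
  F →L[ℝ] F →L[ℝ] F

namespace BilinearOperation

variable {F : Type*} [NormedAddCommGroup F] [NormedSpace ℝ F]

set_option synthInstance.maxHeartbeats 200000 in
instance : NormedAddCommGroup (BilinearOperation F) :=
  inferInstanceAs (NormedAddCommGroup (F →L[ℝ] F →L[ℝ] F))

set_option synthInstance.maxHeartbeats 200000 in
instance : NormedSpace ℝ (BilinearOperation F) :=
  inferInstanceAs (NormedSpace ℝ (F →L[ℝ] F →L[ℝ] F))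

set_option synthInstance.maxHeartbeats 200000 in
instance [FiniteDimensional ℝ F] : FiniteDimensional ℝ (BilinearOperation F) :=
  inferInstanceAs (FiniteDimensional ℝ (F →L[ℝ] F →L[ℝ] F))

/-- A bilinear operation as a continuous bilinear map. -/
def toCLM (β : BilinearOperation F) : F →L[ℝ] F →L[ℝ] F := β

/-- The value of a bilinear operation. -/
def apply (β : BilinearOperation F) (u v : F) : F :=
  β.toCLM u v

instance : CoeFun (BilinearOperation F) fun _ => F → F → F := ⟨apply⟩

variable (β γ : BilinearOperation F) (u v u' v' : F) (c : ℝ)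

theorem add_apply : (β + γ) u v = β u v + γ u v := rfl
theorem sub_apply : (β - γ) u v = β u v - γ u v := rfl
theorem smul_apply : (c • β) u v = c • β u v := rfl
theorem zero_apply : (0 : BilinearOperation F) u v = 0 := rfl
theorem map_add_left : β (u + u') v = β u v + β u' v :=
  ContinuousLinearMap.map_add₂ β.toCLM u u' v
theorem map_smul_left : β (c • u) v = c • β u v :=
  ContinuousLinearMap.map_smul₂ β.toCLM c u v
theorem map_add_right : β u (v + v') = β u v + β u v' :=
  ContinuousLinearMap.map_add (β.toCLM u) v v'
theorem map_smul_right : β u (c • v) = c • β u v :=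
  ContinuousLinearMap.map_smul (β.toCLM u) c v

variable {β γ} in
@[ext]
theorem ext (h : ∀ u v, β u v = γ u v) : β = γ :=
  ContinuousLinearMap.ext fun u => ContinuousLinearMap.ext fun v => h u v

theorem norm_apply_le : ‖β u v‖ ≤ ‖β‖ * ‖u‖ * ‖v‖ :=
  ContinuousLinearMap.le_opNorm₂ β.toCLM u v

variable {β} in
theorem norm_le {C : ℝ} (hC : 0 ≤ C) (h : ∀ u v, ‖β u v‖ ≤ C * ‖u‖ * ‖v‖) : ‖β‖ ≤ C :=
  ContinuousLinearMap.opNorm_le_bound₂ β.toCLM hC h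

/-- The bilinear operation of a bilinear map on a finite-dimensional space. -/
def ofLinearMap [FiniteDimensional ℝ F] (f : F →ₗ[ℝ] F →ₗ[ℝ] F) : BilinearOperation F :=
  LinearMap.toContinuousLinearMap (LinearMap.toContinuousLinearMap.toLinearMap ∘ₗ f)

theorem ofLinearMap_apply [FiniteDimensional ℝ F] (f : F →ₗ[ℝ] F →ₗ[ℝ] F) :
    ofLinearMap f u v = f u v := rfl

section Calculus

variable {X : Type*} [NormedAddCommGroup X] [NormedSpace ℝ X]

theorem contDiffOn_iff [FiniteDimensional ℝ F] {n : WithTop ℕ∞} {f : X → BilinearOperation F}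
    {s : Set X} : ContDiffOn ℝ n f s ↔ ∀ u v, ContDiffOn ℝ n (fun y => f y u v) s := by
  have h1 := contDiffOn_clm_apply (𝕜 := ℝ) (n := n) (E := F) (F := F →L[ℝ] F)
    (f := f) (s := s)
  have h2 := fun u => contDiffOn_clm_apply (𝕜 := ℝ) (n := n) (E := F) (F := F)
    (f := fun y => (f y).toCLM u) (s := s)
  exact h1.trans (forall_congr' h2)

theorem contDiff_iff [FiniteDimensional ℝ F] {n : WithTop ℕ∞} {f : X → BilinearOperation F} :
    ContDiff ℝ n f ↔ ∀ u v, ContDiff ℝ n (fun y => f y u v) := by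
  simp_rw [← contDiffOn_univ, contDiffOn_iff]

theorem _root_.ContDiff.bilinearOperation_apply {n : WithTop ℕ∞} {f : X → BilinearOperation F}
    {g h : X → F} (hf : ContDiff ℝ n f) (hg : ContDiff ℝ n g) (hh : ContDiff ℝ n h) :
    ContDiff ℝ n (fun x => f x (g x) (h x)) :=
  (ContDiff.clm_apply (F := F) (G := F →L[ℝ] F) (f := f) hf hg).clm_apply hh

theorem _root_.HasDerivAt.bilinearOperation_apply {f : ℝ → BilinearOperation F}
    {f' : BilinearOperation F} {g h : ℝ → F} {g' h' : F} {t : ℝ} (hf : HasDerivAt f f' t)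
    (hg : HasDerivAt g g' t) (hh : HasDerivAt h h' t) :
    HasDerivAt (fun x => f x (g x) (h x))
      (f' (g t) (h t) + f t g' (h t) + f t (g t) h') t :=
  (HasDerivAt.clm_apply (F := F) (G := F →L[ℝ] F) (c := f) hf hg).clm_apply hh

theorem _root_.HasDerivAt.bilinearOperation_apply_const {f : ℝ → BilinearOperation F}
    {f' : BilinearOperation F} {t : ℝ} (hf : HasDerivAt f f' t) (u v : F) :
    HasDerivAt (fun x => f x u v) (f' u v) t := by
  refine (hf.bilinearOperation_apply (hasDerivAt_const t u) (hasDerivAt_const t v)).congr_deriv ?_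
  have e1 : f t 0 v = 0 := by simpa using (f t).map_smul_left 0 v 0
  have e2 : f t u 0 = 0 := by simpa using (f t).map_smul_right u 0 0
  rw [e1, e2, add_zero, add_zero]

end Calculus

theorem toCLM_apply : β.toCLM u v = β u v := rfl

attribute [irreducible] apply

/-- The infinitesimal action of an endomorphism `η` on a bilinear operation `β`. -/
def infinitesimalAction [FiniteDimensional ℝ F] (η : F →L[ℝ] F) : BilinearOperation F :=
  ofLinearMap <| LinearMap.mk₂ ℝ (fun u v => η (β u v) - β (η u) v - β u (η v))
    (fun u u' v => by simp only [map_add, map_add_left]; abel)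
    (fun c u v => by simp only [map_smul, map_smul_left, smul_sub])
    (fun u v v' => by simp only [map_add, map_add_right]; abel)
    (fun c u v => by simp only [map_smul, map_smul_right, smul_sub])

variable [FiniteDimensional ℝ F]

theorem infinitesimalAction_apply (η : F →L[ℝ] F) :
    β.infinitesimalAction η u v = η (β u v) - β (η u) v - β u (η v) := by
  simp [infinitesimalAction, ofLinearMap_apply]

theorem infinitesimalAction_add (η : F →L[ℝ] F) :
    (β + γ).infinitesimalAction η = β.infinitesimalAction η + γ.infinitesimalAction η := by
  ext u v
  simp only [infinitesimalAction_apply, add_apply, map_add]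
  abel

theorem norm_infinitesimalAction_le (η : F →L[ℝ] F) :
    ‖β.infinitesimalAction η‖ ≤ 3 * ‖η‖ * ‖β‖ := by
  refine norm_le (by positivity) fun u v => ?_
  rw [infinitesimalAction_apply]
  have h1 : ‖η (β u v)‖ ≤ ‖η‖ * (‖β‖ * ‖u‖ * ‖v‖) := η.le_opNorm_of_le (β.norm_apply_le u v)
  have h2 : ‖β (η u) v‖ ≤ ‖β‖ * (‖η‖ * ‖u‖) * ‖v‖ :=
    (β.norm_apply_le _ v).trans (by gcongr; exact η.le_opNorm u)
  have h3 : ‖β u (η v)‖ ≤ ‖β‖ * ‖u‖ * (‖η‖ * ‖v‖) :=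
    (β.norm_apply_le u _).trans (by gcongr; exact η.le_opNorm v)
  calc _ ≤ ‖η (β u v)‖ + ‖β (η u) v‖ + ‖β u (η v)‖ :=
        (norm_sub_le _ _).trans (by gcongr; exact norm_sub_le _ _)
    _ ≤ ‖η‖ * (‖β‖ * ‖u‖ * ‖v‖) + ‖β‖ * (‖η‖ * ‖u‖) * ‖v‖ + ‖β‖ * ‖u‖ * (‖η‖ * ‖v‖) := by gcongr
    _ = _ := by ring

/-- The infinitesimal orbit map of a bilinear operation `β`. -/
def infinitesimalOrbit : (F →L[ℝ] F) →ₗ[ℝ] BilinearOperation F where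
  toFun η := β.infinitesimalAction η
  map_add' η ζ := by
    ext u v
    simp only [infinitesimalAction_apply, add_apply, _root_.add_apply, map_add_left, map_add_right]
    abel
  map_smul' c η := by
    ext u v
    simp [infinitesimalAction_apply, smul_apply, map_smul_left, map_smul_right, smul_sub]

/-- The defect of `1 + k` to intertwine `b` and `β + w`, as a function of `(b, k, w)`. -/
def intertwiningDefect (p : BilinearOperation F × ((F →L[ℝ] F) × BilinearOperation F)) :
    BilinearOperation F :=
  ofLinearMap <| LinearMap.mk₂ ℝ
    (fun u v => p.1 u v + p.2.1 (p.1 u v) - (β + p.2.2) (u + p.2.1 u) (v + p.2.1 v))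
    (fun u u' v => by simp only [map_add, map_add_left]; abel)
    (fun c u v => by simp only [map_smul, map_smul_left, smul_sub, ← smul_add])
    (fun u v v' => by simp only [map_add, map_add_right]; abel)
    (fun c u v => by simp only [map_smul, map_smul_right, smul_sub, ← smul_add])

theorem intertwiningDefect_apply
    (p : BilinearOperation F × ((F →L[ℝ] F) × BilinearOperation F)) :
    β.intertwiningDefect p u v =
      p.1 u v + p.2.1 (p.1 u v) - (β + p.2.2) (u + p.2.1 u) (v + p.2.1 v) := by
  simp [intertwiningDefect, ofLinearMap_apply]

theorem contDiff_intertwiningDefect : ContDiff ℝ ω β.intertwiningDefect := by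
  refine contDiff_iff.2 fun u v => ?_
  simp only [intertwiningDefect_apply]
  have h1 : ContDiff ℝ ω
      (fun p : BilinearOperation F × ((F →L[ℝ] F) × BilinearOperation F) => p.1 u v) :=
    contDiff_fst.bilinearOperation_apply contDiff_const contDiff_const
  have h2 : ∀ w : F, ContDiff ℝ ω
      (fun p : BilinearOperation F × ((F →L[ℝ] F) × BilinearOperation F) => w + p.2.1 w) :=
    fun w => contDiff_const.add (contDiff_snd.fst.clm_apply contDiff_const)
  exact (h1.add (contDiff_snd.fst.clm_apply h1)).sub
    ((contDiff_const.add contDiff_snd.snd).bilinearOperation_apply (h2 u) (h2 v))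

theorem hasDerivAt_intertwiningDefect (q : (F →L[ℝ] F) × BilinearOperation F) :
    HasDerivAt (fun t : ℝ => β.intertwiningDefect (β, t • q))
      (β.infinitesimalOrbit q.1 - q.2) 0 := by
  have ha : HasDerivAt (fun t : ℝ => t) 1 (0:ℝ) := hasDerivAt_id _
  have h0 : ContDiff ℝ ω (fun t : ℝ => (β, t • q)) :=
    contDiff_const.prodMk (contDiff_id.smul (contDiff_const (c := q)))
  have hd : ContDiff ℝ ω (fun t : ℝ => β.intertwiningDefect (β, t • q)) :=
    β.contDiff_intertwiningDefect.comp h0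
  have h2 := (hd.differentiable (by simp) 0).hasDerivAt
  set f := (fun t : ℝ => β.intertwiningDefect (β, t • q)) with hf
  refine h2.congr_deriv ?_
  have hg : ∀ x : F, HasDerivAt (fun t : ℝ => x + t • q.1 x) (q.1 x) 0 := fun x => by
    simpa using (ha.smul_const (q.1 x)).const_add x
  have hw : HasDerivAt (fun t : ℝ => β + t • q.2) q.2 0 := by
    simpa using (ha.smul_const q.2).const_add β
  ext u v
  have h3 := h2.bilinearOperation_apply_const u v
  have h4 := (hg (β u v)).sub (hw.bilinearOperation_apply (hg u) (hg v))
  refine h3.unique ?_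
  convert! h4 using 1
  · ext t
    simp [hf, intertwiningDefect_apply]
  · simp [infinitesimalOrbit, infinitesimalAction_apply, sub_apply]
    abel

theorem exists_slice :
    ∃ (g : BilinearOperation F → (F →L[ℝ] F)) (w : BilinearOperation F → BilinearOperation F)
      (P : BilinearOperation F →L[ℝ] BilinearOperation F),
      w β = 0 ∧ (∀ η, P (β.infinitesimalAction η) = 0) ∧ (∀ b, P (w b) = w b) ∧
      ∀ᶠ b in 𝓝 β, ContDiffAt ℝ ω g b ∧ ContDiffAt ℝ ω w b ∧ IsUnit (g b) ∧
        ∀ u v, g b (b u v) = (β + w b) (g b u) (g b v) := by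
  have hf0 : β.intertwiningDefect (β, 0) = 0 := by
    ext u v
    simp [intertwiningDefect_apply, zero_apply]
  obtain ⟨g, w, P, hg0, hw0, hPT, hPw, h⟩ := exists_slice_of_hasDerivAt β.infinitesimalOrbit
    β.contDiff_intertwiningDefect hf0 β.hasDerivAt_intertwiningDefect
  refine ⟨fun b => 1 + g b, w, P, hw0, hPT, hPw, ?_⟩
  have hu : ∀ᶠ b in 𝓝 β, IsUnit (1 + g b) := by
    refine (continuousAt_const.add h.self_of_nhds.1.continuousAt).eventually_mem
      (Units.isOpen.mem_nhds ?_)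
    simp [hg0]
  filter_upwards [h, hu] with b h1 h2
  refine ⟨contDiffAt_const.add h1.1, h1.2.1, h2, fun u v => ?_⟩
  have h3 := h1.2.2
  have := congr($h3 u v)
  rw [intertwiningDefect_apply, zero_apply] at this
  exact sub_eq_zero.1 this

end BilinearOperation

namespace BilinearOperation

variable {F : Type*} [NormedAddCommGroup F] [NormedSpace ℝ F] [FiniteDimensional ℝ F]

/-- If `G` intertwines `B` with `β` and `B'` is the infinitesimal action of `θ` on `B`, then the
derivative of `β` is an infinitesimal action too. -/
theorem eq_infinitesimalAction_of_intertwining {G Ginv G' θ : F →L[ℝ] F}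
    {B B' β β' : BilinearOperation F} (h1 : ∀ x, G (Ginv x) = x) (h2 : ∀ x, Ginv (G x) = x)
    (hB : ∀ u v, G (B u v) = β (G u) (G v))
    (hB' : B' = B.infinitesimalAction θ)
    (hd : ∀ u v, G' (B u v) + G (B' u v) =
      β' (G u) (G v) + β (G' u) (G v) + β (G u) (G' v)) :
    β' = β.infinitesimalAction ((G' + G.comp θ).comp Ginv) := by
  ext x y
  obtain ⟨u, rfl⟩ : ∃ u, G u = x := ⟨_, h1 x⟩
  obtain ⟨v, rfl⟩ : ∃ v, G v = y := ⟨_, h1 y⟩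
  have h := hd u v
  rw [hB', infinitesimalAction_apply, map_sub, map_sub, hB (θ u), hB u (θ v)] at h
  rw [infinitesimalAction_apply, ← hB u v]
  simp only [ContinuousLinearMap.comp_apply, _root_.add_apply, h2, map_add_left, map_add_right]
  rw [← sub_eq_zero]
  rw [← sub_eq_zero] at h
  rw [← neg_eq_zero, ← h]
  abel

variable {E : Type*} [NormedAddCommGroup E] [NormedSpace ℝ E]

theorem exists_intertwining {b : E → BilinearOperation F} {z₀ : E} {O : Set E} (hO : O ∈ 𝓝 z₀)
    (hb : ContDiffOn ℝ ∞ b O) (θ : E → E → (F →L[ℝ] F)) (hθ : ∀ v, ContinuousOn (θ · v) O)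
    (hd : ∀ z ∈ O, ∀ v, fderiv ℝ b z v = (b z).infinitesimalAction (θ z v)) :
    ∃ r > 0, Metric.ball z₀ r ⊆ O ∧ ∃ g : E → (F →L[ℝ] F),
      ContDiffOn ℝ ∞ g (Metric.ball z₀ r) ∧ ∀ z ∈ Metric.ball z₀ r, IsUnit (g z) ∧
        ∀ u v, g z (b z u v) = b z₀ (g z u) (g z v) := by
  obtain ⟨g, w, P, hw0, hP0, hPw, hev⟩ := (b z₀).exists_slice
  have hbc : ContinuousAt b z₀ := hb.continuousOn.continuousAt hO
  obtain ⟨r, hr, hball⟩ := Metric.eventually_nhds_iff_ball.1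
    ((hbc.eventually hev).and (eventually_eventually_nhds.2 hO))
  have hsub : Metric.ball z₀ r ⊆ O := fun z hz => mem_of_mem_nhds (hball z hz).2
  have hbA : ∀ z ∈ Metric.ball z₀ r, ContDiffAt ℝ ∞ b z := fun z hz => hb.contDiffAt (hball z hz).2
  have hgA : ∀ z ∈ Metric.ball z₀ r, ContDiffAt ℝ ∞ (fun y => g (b y)) z := fun z hz =>
    ((hball z hz).1.1.of_le le_top).comp z (hbA z hz)
  have hwA : ∀ z ∈ Metric.ball z₀ r, ContDiffAt ℝ ∞ (fun y => w (b y)) z := fun z hz =>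
    ((hball z hz).1.2.1.of_le le_top).comp z (hbA z hz)
  refine ⟨r, hr, hsub, fun z => g (b z), fun z hz => (hgA z hz).contDiffWithinAt, fun y hy =>
    ⟨(hball y hy).1.2.2.1, ?_⟩⟩
  suffices h : w (b y) = 0 by
    have := (hball y hy).1.2.2.2
    rwa [h, add_zero] at this
  set γ : ℝ → E := fun t => z₀ + t • (y - z₀) with hγ
  have hγd : ∀ t, HasDerivAt γ (y - z₀) t := fun t => by
    exact (((hasDerivAt_id t).smul_const (y - z₀)).const_add z₀).congr_deriv (one_smul _ _)
  have hγc : ContDiff ℝ ∞ γ := contDiff_const.add (contDiff_id.smul (contDiff_const (c := y - z₀)))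
  set J : Set ℝ := γ ⁻¹' Metric.ball z₀ r with hJ
  have hJo : IsOpen J := Metric.isOpen_ball.preimage hγc.continuous
  have hIJ : Icc 0 1 ⊆ J := by
    intro t ht
    have hy' : ‖y - z₀‖ < r := by simpa [dist_eq_norm] using hy
    simp only [hJ, hγ, mem_preimage, Metric.mem_ball, dist_eq_norm, add_sub_cancel_left, norm_smul]
    rw [Real.norm_of_nonneg ht.1]
    exact (mul_le_of_le_one_left (norm_nonneg _) ht.2).trans_lt hy'
  set G : ℝ → (F →L[ℝ] F) := fun t => g (b (γ t)) with hG
  set W : ℝ → BilinearOperation F := fun t => w (b (γ t)) with hW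
  have hGc : ContDiffOn ℝ ∞ G J := fun t ht =>
    ((hgA _ ht).comp t hγc.contDiffAt).contDiffWithinAt
  have hWc : ContDiffOn ℝ ∞ W J := fun t ht =>
    ((hwA _ ht).comp t hγc.contDiffAt).contDiffWithinAt
  have hGd : ∀ t ∈ J, HasDerivAt G (deriv G t) t := fun t ht =>
    ((hGc.contDiffAt (hJo.mem_nhds ht)).differentiableAt (by simp)).hasDerivAt
  have hWd : ∀ t ∈ J, HasDerivAt W (deriv W t) t := fun t ht =>
    ((hWc.contDiffAt (hJo.mem_nhds ht)).differentiableAt (by simp)).hasDerivAt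
  have hBd : ∀ t ∈ J, HasDerivAt (fun t => b (γ t))
      ((b (γ t)).infinitesimalAction (θ (γ t) (y - z₀))) t := fun t ht => by
    rw [← hd _ (hsub ht)]
    exact ((hbA _ ht).differentiableAt (by simp)).hasFDerivAt.comp_hasDerivAt t (hγd t)
  set η : ℝ → (F →L[ℝ] F) := fun t =>
    (deriv G t + (G t).comp (θ (γ t) (y - z₀))).comp (Ring.inverse (G t)) with hη
  have hηc : ContinuousOn η J := by
    have e1 : ContinuousOn (deriv G) J := hGc.continuousOn_deriv_of_isOpen hJo (by simp)
    have e2 : ContinuousOn (fun t => θ (γ t) (y - z₀)) J :=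
      (hθ (y - z₀)).comp hγc.continuous.continuousOn fun t ht => hsub ht
    have e3 : ContinuousOn (fun t => Ring.inverse (G t)) J := fun t ht => by
      obtain ⟨u, hu⟩ := (hball _ ht).1.2.2.1
      have h4 : ContinuousAt Ring.inverse (G t) := by
        rw [hG]
        simp only
        rw [← hu]
        exact NormedRing.inverse_continuousAt u
      exact (h4.comp (hGc.continuousOn.continuousAt (hJo.mem_nhds ht))).continuousWithinAt
    exact (e1.add (hGc.continuousOn.clm_comp e2)).clm_comp e3
  have hWη : ∀ t ∈ J, deriv W t = (b z₀ + W t).infinitesimalAction (η t) := by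
    intro t ht
    have hu := (hball _ ht).1.2.2.1
    refine eq_infinitesimalAction_of_intertwining (G := G t) (B := b (γ t)) (fun x => ?_)
      (fun x => ?_) (hball _ ht).1.2.2.2 rfl fun u v => ?_
    · exact congr($(Ring.mul_inverse_cancel _ hu) x)
    · exact congr($(Ring.inverse_mul_cancel _ hu) x)
    · have e1 : HasDerivAt (fun t => G t (b (γ t) u v)) (deriv G t (b (γ t) u v) +
          G t ((b (γ t)).infinitesimalAction (θ (γ t) (y - z₀)) u v)) t := by
        exact (hGd t ht).clm_apply ((hBd t ht).bilinearOperation_apply_const u v)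
      have hGu : ∀ u, HasDerivAt (fun t => G t u) (deriv G t u) t := fun u => by
        simpa using (hGd t ht).clm_apply (hasDerivAt_const t u)
      have e2 := ((hWd t ht).const_add (b z₀)).bilinearOperation_apply (hGu u) (hGu v)
      refine e1.unique (e2.congr_of_eventuallyEq ?_)
      filter_upwards [hJo.mem_nhds ht] with s hs
      exact (hball _ hs).1.2.2.2 u v
  have hPW : ∀ t ∈ J, deriv W t = P ((W t).infinitesimalAction (η t)) := by
    intro t ht
    have e1 : HasDerivAt (fun t => P (W t)) (P (deriv W t)) t :=
      P.hasFDerivAt.comp_hasDerivAt t (hWd t ht)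
    have e2 : (fun t => P (W t)) = W := funext fun t => hPw _
    rw [e2] at e1
    rw [(hWd t ht).unique e1, hWη t ht, infinitesimalAction_add, map_add, hP0, zero_add]
  obtain ⟨K, hK⟩ := isCompact_Icc.exists_bound_of_continuousOn (hηc.mono hIJ)
  have key := eq_zero_of_abs_deriv_le_mul_abs_self_of_eq_zero_right (f := W) (f' := deriv W)
    (K := ‖P‖ * (3 * K)) (a := 0) (b := 1) (hWc.continuousOn.mono hIJ)
    (fun t ht => (hWd t (hIJ (Ico_subset_Icc_self ht))).hasDerivWithinAt)
    (by simp [hW, hγ, hw0]) (fun t ht => ?_) 1 (by simp)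
  · simpa [hW, hγ] using key
  · rw [hPW t (hIJ (Ico_subset_Icc_self ht)), mul_assoc]
    refine P.le_opNorm_of_le ((norm_infinitesimalAction_le _ _).trans ?_)
    gcongr
    exact hK t (Ico_subset_Icc_self ht)

end BilinearOperation

/-- A flat connection with parallel torsion: the torsion satisfies the Jacobi identity. -/
theorem LinearMap.torsion_jacobi {R N : Type*} [CommRing R] [AddCommGroup N] [Module R N]
    (D br : N →ₗ[R] N →ₗ[R] N) {S : N → N → N} (hS : ∀ x y, S x y = D y x - D x y + br x y)
    (hskew : ∀ x y, br x y = -br y x)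
    (hjac : ∀ x y z, br x (br y z) + br y (br z x) + br z (br x y) = 0)
    (hrep : ∀ x y z, D (br x y) z = D x (D y z) - D y (D x z))
    (hder : ∀ x y z, D x (S y z) = S (D x y) z + S y (D x z)) (x y z : N) :
    S x (S y z) + S y (S z x) + S z (S x y) = 0 := by
  have hneg : ∀ x y, S x y = -S y x := fun x y => by
    rw [hS, hS, hskew x y]
    abel
  have hSr : ∀ x y z w, S x (y - z + w) = S x y - S x z + S x w := fun x y z w => by
    simp only [hS, map_add, map_sub, LinearMap.add_apply, LinearMap.sub_apply]
    abel
  have e1 := hder x y z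
  have e2 := hder y z x
  have e3 := hder z x y
  rw [hneg (D x y) z] at e1
  rw [hneg (D y z) x] at e2
  rw [hneg (D z x) y] at e3
  have j := hjac x y z
  have r1 := hrep y z x
  have r2 := hrep z x y
  have r3 := hrep x y z
  have expand : S x (S y z) + S y (S z x) + S z (S x y) =
      D x (S y z) + D y (S z x) + D z (S x y) + S x (br y z) + S y (br z x) + S z (br x y) := by
    rw [e1, e2, e3, hS y z, hS z x, hS x y, hSr, hSr, hSr]
    abel
  rw [expand, hS x (br y z), hS y (br z x), hS z (br x y), hS y z, hS z x, hS x y, r1, r2, r3]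
  simp only [map_add, map_sub]
  rw [← j]
  abel

namespace LieAlgebroid

variable {E : Type*} [NormedAddCommGroup E] [NormedSpace ℝ E]
  {M : Type*} [TopologicalSpace M] [ChartedSpace E M] [IsManifold 𝓘(ℝ, E) ∞ M]
  {F : Type*} [NormedAddCommGroup F] [NormedSpace ℝ F]
  {V : M → Type*} [TopologicalSpace (TotalSpace F V)] [∀ x, TopologicalSpace (V x)]
  [∀ x, AddCommGroup (V x)] [∀ x, Module ℝ (V x)] [FiberBundle F V] [VectorBundle ℝ F V]

theorem bracket_smul_left (A : LieAlgebroid E F V) (f : C^∞⟮𝓘(ℝ, E), M; 𝓘(ℝ, ℝ), ℝ⟯)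
    (σ τ : Cₛ^∞⟮𝓘(ℝ, E); F, V⟯) (x : M) :
    A.bracket (f • σ) τ x =
      f x • A.bracket σ τ x - directionalDeriv f x (A.anchor x (τ x)) • σ x := by
  rw [A.bracket_skew, A.bracket_skew σ τ, ContMDiffSection.coe_neg, Pi.neg_apply,
    A.bracket_leibniz, ContMDiffSection.coe_neg, Pi.neg_apply, smul_neg]
  abel

namespace SelfConnection

variable {A : LieAlgebroid E F V} (C : A.SelfConnection)

theorem symBracket_eq (σ τ : Cₛ^∞⟮𝓘(ℝ, E); F, V⟯) :
    C.symBracket σ τ = C.D τ σ - C.D σ τ + A.bracket σ τ := by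
  rw [symBracket, torsion]
  abel

theorem symBracket_neg (σ τ : Cₛ^∞⟮𝓘(ℝ, E); F, V⟯) :
    C.symBracket σ τ = -C.symBracket τ σ := by
  rw [symBracket_eq, symBracket_eq, A.bracket_skew σ τ]
  abel

theorem symBracket_self (σ : Cₛ^∞⟮𝓘(ℝ, E); F, V⟯) : C.symBracket σ σ = 0 := by
  have h : A.bracket σ σ = 0 := by
    have h2 : (2 : ℝ) • A.bracket σ σ = 0 := by
      rw [two_smul]
      exact eq_neg_iff_add_eq_zero.1 (A.bracket_skew σ σ)
    exact (smul_eq_zero.1 h2).resolve_left two_ne_zero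
  rw [symBracket_eq, h]
  abel

theorem symBracket_add_left (σ σ' τ : Cₛ^∞⟮𝓘(ℝ, E); F, V⟯) :
    C.symBracket (σ + σ') τ = C.symBracket σ τ + C.symBracket σ' τ := by
  simp only [symBracket_eq, map_add, LinearMap.add_apply]
  abel

theorem symBracket_add_right (σ τ τ' : Cₛ^∞⟮𝓘(ℝ, E); F, V⟯) :
    C.symBracket σ (τ + τ') = C.symBracket σ τ + C.symBracket σ τ' := by
  simp only [symBracket_eq, map_add, LinearMap.add_apply]
  abel

theorem symBracket_smul_left (f : C^∞⟮𝓘(ℝ, E), M; 𝓘(ℝ, ℝ), ℝ⟯) (σ τ : Cₛ^∞⟮𝓘(ℝ, E); F, V⟯) :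
    C.symBracket (f • σ) τ = f • C.symBracket σ τ := by
  ext x
  simp only [symBracket_eq, ContMDiffSection.coe_add, ContMDiffSection.coe_sub, Pi.add_apply,
    Pi.sub_apply, ContMDiffSection.smoothFunction_smul_apply, C.smul_left, C.leibniz,
    A.bracket_smul_left, smul_add, smul_sub]
  abel

theorem symBracket_smul_right (f : C^∞⟮𝓘(ℝ, E), M; 𝓘(ℝ, ℝ), ℝ⟯) (σ τ : Cₛ^∞⟮𝓘(ℝ, E); F, V⟯) :
    C.symBracket σ (f • τ) = f • C.symBracket σ τ := by
  rw [symBracket_neg, symBracket_smul_left, C.symBracket_neg σ τ, smul_neg]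

variable {C}

theorem IsLocallySymmetric.D_symBracket (h : C.IsLocallySymmetric)
    (ρ σ τ : Cₛ^∞⟮𝓘(ℝ, E); F, V⟯) :
    C.D ρ (C.symBracket σ τ) = C.symBracket (C.D ρ σ) τ + C.symBracket σ (C.D ρ τ) := by
  have := h ρ σ τ
  rw [derivTorsion, sub_sub, sub_eq_zero] at this
  simp only [symBracket, map_neg, this]
  abel

theorem isLieAlgebraicBracket_symBracket (hrep : C.IsRepresentation)
    (hsym : C.IsLocallySymmetric) :
    IsLieAlgebraicBracket C^∞⟮𝓘(ℝ, E), M; 𝓘(ℝ, ℝ), ℝ⟯ C.symBracket where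
  add_left := C.symBracket_add_left
  add_right := C.symBracket_add_right
  smul_left := C.symBracket_smul_left
  smul_right := fun f σ τ => C.symBracket_smul_right f σ τ
  self := C.symBracket_self
  jacobi := LinearMap.torsion_jacobi C.D A.bracket C.symBracket_eq A.bracket_skew A.jacobi
    (fun σ τ ρ => (sub_eq_zero.1 (hrep σ τ ρ)).symm) hsym.D_symBracket

theorem ExtendsCanonical.bracket_eq (h : C.ExtendsCanonical) {s t : Cₛ^∞⟮𝓘(ℝ, E); F, V⟯}
    (hs : A.IsKernelSection s) (ht : A.IsKernelSection t) :
    A.bracket s t = -C.symBracket s t := by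
  rw [symBracket_eq, h t s hs, h s t ht, A.bracket_skew t s]
  abel

theorem ExtendsCanonical.D_eq (h : C.ExtendsCanonical) {s : Cₛ^∞⟮𝓘(ℝ, E); F, V⟯}
    (hs : A.IsKernelSection s) (τ : Cₛ^∞⟮𝓘(ℝ, E); F, V⟯) :
    C.D s τ = -C.symBracket s τ := by
  rw [symBracket_eq, h τ s hs, A.bracket_skew τ s]
  abel

end SelfConnection

end LieAlgebroid

section CutoffFrames

variable {E : Type*} [NormedAddCommGroup E] [NormedSpace ℝ E]
  {M : Type*} [TopologicalSpace M] [ChartedSpace E M]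
  {F : Type*} [NormedAddCommGroup F] [NormedSpace ℝ F]
  {V : M → Type*} [TopologicalSpace (TotalSpace F V)] [∀ x, TopologicalSpace (V x)]
  [∀ x, AddCommGroup (V x)] [∀ x, Module ℝ (V x)] [FiberBundle F V] [VectorBundle ℝ F V]

theorem Bundle.Trivialization.contDiffOn_extChartAt_symm [IsManifold 𝓘(ℝ, E) ∞ M]
    [ContMDiffVectorBundle ∞ F V 𝓘(ℝ, E)]
    (e : Trivialization F (TotalSpace.proj : TotalSpace F V → M)) [MemTrivializationAtlas e] (x₀ : M)
    {s : ∀ x, V x}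
    (hs : ContMDiff 𝓘(ℝ, E) (𝓘(ℝ, E).prod 𝓘(ℝ, F)) ∞ (fun x => (⟨x, s x⟩ : TotalSpace F V))) :
    ContDiffOn ℝ ∞ (fun z => e.continuousLinearMapAt ℝ ((extChartAt 𝓘(ℝ, E) x₀).symm z)
        (s ((extChartAt 𝓘(ℝ, E) x₀).symm z)))
      ((extChartAt 𝓘(ℝ, E) x₀).target ∩ (extChartAt 𝓘(ℝ, E) x₀).symm ⁻¹' e.baseSet) := by
  have h1 : ContMDiffOn 𝓘(ℝ, E) 𝓘(ℝ, F) ∞ (fun x => e.continuousLinearMapAt ℝ x (s x))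
      e.baseSet := by
    refine (e.contMDiffOn_section_baseSet_iff.1 hs.contMDiffOn).congr fun x hx =>
      e.continuousLinearMapAt_apply_of_mem ℝ hx _
  rw [← contMDiffOn_iff_contDiffOn]
  exact h1.comp ((contMDiffOn_extChartAt_symm x₀).mono inter_subset_left) inter_subset_right

variable [FiniteDimensional ℝ E] [T2Space M] [IsManifold 𝓘(ℝ, E) ∞ M]
  [ContMDiffVectorBundle ∞ F V 𝓘(ℝ, E)] {x₀ : M} (χ : SmoothBumpFunction 𝓘(ℝ, E) x₀)
  {e : Trivialization F (TotalSpace.proj : TotalSpace F V → M)} [MemTrivializationAtlas e]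
  (hχ : tsupport χ ⊆ e.baseSet)

namespace SmoothBumpFunction

/-- The constant section `f` in the trivialization `e`, cut off by `χ`. -/
def frameSection : F →ₗ[ℝ] Cₛ^∞⟮𝓘(ℝ, E); F, V⟯ where
  toFun f := ⟨fun x => χ x • e.symmL ℝ x f, by
    refine χ.contMDiff.contMDiffOn.smul_section_of_tsupport (s := fun x => e.symmL ℝ x f)
      e.open_baseSet hχ ?_
    rw [e.contMDiffOn_section_baseSet_iff]
    refine (contMDiffOn_const (c := f)).congr fun x hx =>
      (e.continuousLinearMapAt_apply_of_mem ℝ hx _).symm.trans (e.linearMapAt_symmₗ hx f)⟩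
  map_add' f g := by
    ext x
    change χ x • e.symmL ℝ x (f + g) = χ x • e.symmL ℝ x f + χ x • e.symmL ℝ x g
    rw [map_add, smul_add]
  map_smul' c f := by
    ext x
    change χ x • e.symmL ℝ x (c • f) = c • χ x • e.symmL ℝ x f
    rw [map_smul, smul_comm]

theorem frameSection_apply (f : F) (x : M) :
    χ.frameSection hχ f x = χ x • e.symmL ℝ x f := rfl

/-- The coefficient `ℓ` of the section `σ` in the trivialization `e`, cut off by `χ`. -/
def sectionCoeff (ℓ : F →L[ℝ] ℝ) (σ : Cₛ^∞⟮𝓘(ℝ, E); F, V⟯) : C^∞⟮𝓘(ℝ, E), M; 𝓘(ℝ, ℝ), ℝ⟯ :=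
  ⟨fun x => χ x * ℓ (e.continuousLinearMapAt ℝ x (σ x)), by
    refine contMDiff_of_tsupport fun x hx => ?_
    have hx' : x ∈ e.baseSet := hχ (closure_mono (Function.support_mul_subset_left _ _) hx)
    refine χ.contMDiffAt.mul (ℓ.contMDiff.contMDiffAt.comp x ?_)
    refine ((e.contMDiffAt_section_iff hx').1 σ.contMDiff.contMDiffAt).congr_of_eventuallyEq ?_
    filter_upwards [e.open_baseSet.mem_nhds hx'] with y hy
    exact e.continuousLinearMapAt_apply_of_mem ℝ hy _⟩

theorem sectionCoeff_apply (ℓ : F →L[ℝ] ℝ) (σ : Cₛ^∞⟮𝓘(ℝ, E); F, V⟯) (x : M) :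
    χ.sectionCoeff hχ ℓ σ x = χ x * ℓ (e.continuousLinearMapAt ℝ x (σ x)) := rfl

/-- The bump function as a bundled smooth function. -/
def toContMDiffMap : C^∞⟮𝓘(ℝ, E), M; 𝓘(ℝ, ℝ), ℝ⟯ := ⟨χ, χ.contMDiff⟩

variable {ι : Type*} [Fintype ι] (B : Module.Basis ι ℝ F) [FiniteDimensional ℝ F]

theorem sq_smul_eq_sum (σ : Cₛ^∞⟮𝓘(ℝ, E); F, V⟯) :
    (χ.toContMDiffMap * χ.toContMDiffMap) • σ =
      ∑ i, χ.sectionCoeff hχ (LinearMap.toContinuousLinearMap (B.coord i)) σ •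
        χ.frameSection hχ (B i) := by
  ext x
  have h0 : (∑ i, χ.sectionCoeff hχ (LinearMap.toContinuousLinearMap (B.coord i)) σ •
      χ.frameSection hχ (B i)) x = ∑ i, (χ x * B.repr (e.continuousLinearMapAt ℝ x (σ x)) i) •
        χ x • e.symmL ℝ x (B i) := by
    have := congrFun (map_sum (ContMDiffSection.coeAddHom 𝓘(ℝ, E) F ∞ V) (fun i =>
      χ.sectionCoeff hχ (LinearMap.toContinuousLinearMap (B.coord i)) σ •
      χ.frameSection hχ (B i)) Finset.univ) x
    rw [Finset.sum_apply] at this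
    exact this
  rw [h0, ContMDiffSection.smoothFunction_smul_apply]
  change (χ x * χ x) • σ x = _
  by_cases hx : x ∈ e.baseSet
  · have h2 : σ x = e.symmL ℝ x (e.continuousLinearMapAt ℝ x (σ x)) :=
      (e.symmL_continuousLinearMapAt hx _).symm
    conv_lhs => rw [h2, ← B.sum_repr (e.continuousLinearMapAt ℝ x (σ x)), map_sum, Finset.smul_sum]
    refine Finset.sum_congr rfl fun i _ => ?_
    rw [map_smul, smul_smul, smul_smul]
    congr 1
    ring
  · have h3 : χ x = 0 := by
      by_contra h
      exact hx (hχ (subset_closure h))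
    simp [h3]

theorem apply_eq_sum (N : Cₛ^∞⟮𝓘(ℝ, E); F, V⟯ →+ Cₛ^∞⟮𝓘(ℝ, E); F, V⟯)
    (hN : ∀ (f : C^∞⟮𝓘(ℝ, E), M; 𝓘(ℝ, ℝ), ℝ⟯) σ, N (f • σ) = f • N σ)
    (σ : Cₛ^∞⟮𝓘(ℝ, E); F, V⟯) {x : M} (hx : χ x = 1) :
    N σ x = ∑ i, B.repr (e.continuousLinearMapAt ℝ x (σ x)) i • N (χ.frameSection hχ (B i)) x := by
  have h1 := congr($(congrArg N (χ.sq_smul_eq_sum hχ B σ)) x)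
  rw [hN, ContMDiffSection.smoothFunction_smul_apply, map_sum] at h1
  have h0 := congrFun (map_sum (ContMDiffSection.coeAddHom 𝓘(ℝ, E) F ∞ V) (fun i =>
      N (χ.sectionCoeff hχ (LinearMap.toContinuousLinearMap (B.coord i)) σ •
      χ.frameSection hχ (B i))) Finset.univ) x
  rw [Finset.sum_apply] at h0
  have h2 : (χ.toContMDiffMap * χ.toContMDiffMap) x = 1 := by
    change χ x * χ x = 1
    rw [hx, one_mul]
  rw [h2, one_smul] at h1
  rw [h1]
  refine h0.trans (Finset.sum_congr rfl fun i _ => ?_)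
  rw [hN]
  change (χ x * B.repr (e.continuousLinearMapAt ℝ x (σ x)) i) • N (χ.frameSection hχ (B i)) x = _
  rw [hx, one_mul]

end SmoothBumpFunction

theorem ContMDiffSection.apply_eq_of_tensorial [FiniteDimensional ℝ F]
    (N : Cₛ^∞⟮𝓘(ℝ, E); F, V⟯ →+ Cₛ^∞⟮𝓘(ℝ, E); F, V⟯)
    (hN : ∀ (f : C^∞⟮𝓘(ℝ, E), M; 𝓘(ℝ, ℝ), ℝ⟯) σ, N (f • σ) = f • N σ)
    {σ τ : Cₛ^∞⟮𝓘(ℝ, E); F, V⟯} {x : M} (h : σ x = τ x) : N σ x = N τ x := by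
  obtain ⟨χ, hχ, -⟩ := (SmoothBumpFunction.nhds_basis_support (I := 𝓘(ℝ, E)) (c := x)
    ((trivializationAt F V x).open_baseSet.mem_nhds
      (mem_baseSet_trivializationAt F V x))).mem_iff.1 univ_mem
  rw [χ.apply_eq_sum hχ (Module.finBasis ℝ F) N hN σ χ.eq_one,
    χ.apply_eq_sum hχ (Module.finBasis ℝ F) N hN τ χ.eq_one, h]

theorem ContMDiffSection.exists_apply_eq [FiniteDimensional ℝ F] (x : M) :
    ∃ s : V x →ₗ[ℝ] Cₛ^∞⟮𝓘(ℝ, E); F, V⟯, ∀ v, s v x = v := by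
  obtain ⟨χ, hχ, -⟩ := (SmoothBumpFunction.nhds_basis_support (I := 𝓘(ℝ, E)) (c := x)
    ((trivializationAt F V x).open_baseSet.mem_nhds
      (mem_baseSet_trivializationAt F V x))).mem_iff.1 univ_mem
  refine ⟨χ.frameSection hχ ∘ₗ ((trivializationAt F V x).continuousLinearMapAt ℝ x).toLinearMap,
    fun v => ?_⟩
  change χ x • _ = v
  rw [χ.eq_one, one_smul]
  exact (trivializationAt F V x).symmL_continuousLinearMapAt (mem_baseSet_trivializationAt F V x) v

namespace LieAlgebroid.SelfConnection

variable [FiniteDimensional ℝ F] {A : LieAlgebroid E F V} (C : A.SelfConnection)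

theorem symBracket_apply_eq {σ σ' τ τ' : Cₛ^∞⟮𝓘(ℝ, E); F, V⟯} {x : M} (hσ : σ x = σ' x)
    (hτ : τ x = τ' x) : C.symBracket σ τ x = C.symBracket σ' τ' x :=
  (ContMDiffSection.apply_eq_of_tensorial
    (AddMonoidHom.mk' (fun σ => C.symBracket σ τ) fun _ _ => C.symBracket_add_left _ _ _)
    (fun f σ => C.symBracket_smul_left f σ τ) hσ).trans
  (ContMDiffSection.apply_eq_of_tensorial
    (AddMonoidHom.mk' (fun τ => C.symBracket σ' τ) fun _ _ => C.symBracket_add_right _ _ _)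
    (fun f τ => C.symBracket_smul_right f σ' τ) hτ)

theorem D_apply_eq_sum {ι : Type*} [Fintype ι] (B : Module.Basis ι ℝ F)
    (ρ τ : Cₛ^∞⟮𝓘(ℝ, E); F, V⟯) {x : M} (hx : χ =ᶠ[𝓝 x] 1) :
    C.D ρ τ x = ∑ i, (B.repr (e.continuousLinearMapAt ℝ x (τ x)) i •
        C.D ρ (χ.frameSection hχ (B i)) x +
      directionalDeriv (χ.sectionCoeff hχ (LinearMap.toContinuousLinearMap (B.coord i)) τ) x
        (A.anchor x (ρ x)) • χ.frameSection hχ (B i) x) := by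
  have hx1 : χ x = 1 := hx.eq_of_nhds
  have h1 := congr($(congrArg (C.D ρ) (χ.sq_smul_eq_sum hχ B τ)) x)
  have h2 : (χ.toContMDiffMap * χ.toContMDiffMap) x = 1 := by
    change χ x * χ x = 1
    rw [hx1, one_mul]
  have h3 : directionalDeriv (χ.toContMDiffMap * χ.toContMDiffMap) x (A.anchor x (ρ x)) = 0 := by
    have h4 : ⇑(χ.toContMDiffMap * χ.toContMDiffMap) =ᶠ[𝓝 x] fun _ => (1 : ℝ) := by
      filter_upwards [hx] with y hy
      change χ y * χ y = 1
      rw [hy, Pi.one_apply, one_mul]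
    rw [directionalDeriv, h4.mfderiv_eq, mfderiv_const]
    rfl
  rw [C.leibniz, h2, h3, one_smul, zero_smul, add_zero, map_sum] at h1
  have h0 := congrFun (map_sum (ContMDiffSection.coeAddHom 𝓘(ℝ, E) F ∞ V) (fun i =>
      C.D ρ (χ.sectionCoeff hχ (LinearMap.toContinuousLinearMap (B.coord i)) τ •
      χ.frameSection hχ (B i))) Finset.univ) x
  rw [Finset.sum_apply] at h0
  rw [h1]
  refine h0.trans (Finset.sum_congr rfl fun i _ => ?_)
  refine (C.leibniz ρ _ _ x).trans ?_
  congr 2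
  rw [SmoothBumpFunction.sectionCoeff_apply, hx1, one_mul]
  rfl

end LieAlgebroid.SelfConnection

end CutoffFrames

namespace SmoothBumpFunction

variable {E : Type*} [NormedAddCommGroup E] [NormedSpace ℝ E] [FiniteDimensional ℝ E]
  {M : Type*} [TopologicalSpace M] [ChartedSpace E M]
  {x₀ : M} (χ : SmoothBumpFunction 𝓘(ℝ, E) x₀)

/-- The interior of the set where the bump function is one, in the chart. -/
def chartCore : Set E :=
  (extChartAt 𝓘(ℝ, E) x₀).target ∩ (extChartAt 𝓘(ℝ, E) x₀).symm ⁻¹' interior {x | χ x = 1}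

theorem isOpen_chartCore : IsOpen χ.chartCore :=
  (continuousOn_extChartAt_symm x₀).isOpen_inter_preimage (isOpen_extChartAt_target x₀)
    isOpen_interior

theorem mem_chartCore : extChartAt 𝓘(ℝ, E) x₀ x₀ ∈ χ.chartCore := by
  refine ⟨mem_extChartAt_target x₀, ?_⟩
  rw [mem_preimage, extChartAt_to_inv, mem_interior_iff_mem_nhds]
  exact χ.eventuallyEq_one

variable {χ} in
theorem eventuallyEq_one_of_mem_chartCore {z : E} (hz : z ∈ χ.chartCore) :
    χ =ᶠ[𝓝 ((extChartAt 𝓘(ℝ, E) x₀).symm z)] 1 :=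
  mem_interior_iff_mem_nhds.1 hz.2

variable {χ} in
theorem eq_one_of_mem_chartCore {z : E} (hz : z ∈ χ.chartCore) :
    χ ((extChartAt 𝓘(ℝ, E) x₀).symm z) = 1 :=
  (eventuallyEq_one_of_mem_chartCore hz).eq_of_nhds

theorem chartCore_subset {s : Set M} (hs : tsupport χ ⊆ s) : χ.chartCore ⊆
    (extChartAt 𝓘(ℝ, E) x₀).target ∩ (extChartAt 𝓘(ℝ, E) x₀).symm ⁻¹' s :=
  fun _ hz => ⟨hz.1, hs (subset_tsupport _ <| Function.mem_support.2 <|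
    ne_of_eq_of_ne (eq_one_of_mem_chartCore hz) one_ne_zero)⟩

variable [T2Space M] [IsManifold 𝓘(ℝ, E) ∞ M]
  {F : Type*} [NormedAddCommGroup F] [NormedSpace ℝ F]
  {V : M → Type*} [TopologicalSpace (TotalSpace F V)] [∀ x, TopologicalSpace (V x)]
  [∀ x, AddCommGroup (V x)] [∀ x, Module ℝ (V x)] [FiberBundle F V] [VectorBundle ℝ F V]
  [ContMDiffVectorBundle ∞ F V 𝓘(ℝ, E)]
  {e : Trivialization F (TotalSpace.proj : TotalSpace F V → M)} [MemTrivializationAtlas e]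
  (hχ : tsupport χ ⊆ e.baseSet)

variable (e) in
/-- The representation of sections in the chart and the trivialization. -/
def _root_.ContMDiffSection.localRep (x₀ : M) (z : E) : Cₛ^∞⟮𝓘(ℝ, E); F, V⟯ →ₗ[ℝ] F where
  toFun σ := e.continuousLinearMapAt ℝ ((extChartAt 𝓘(ℝ, E) x₀).symm z)
    (σ ((extChartAt 𝓘(ℝ, E) x₀).symm z))
  map_add' _ _ := map_add _ _ _
  map_smul' c _ := map_smul _ c _

open ContMDiffSection

omit [T2Space M] in
include hχ in
theorem contDiffOn_localRep (σ : Cₛ^∞⟮𝓘(ℝ, E); F, V⟯) :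
    ContDiffOn ℝ ∞ (fun z => localRep e x₀ z σ) χ.chartCore :=
  (e.contDiffOn_extChartAt_symm x₀ σ.contMDiff).mono (χ.chartCore_subset hχ)

theorem localRep_frameSection {z : E} (hz : z ∈ χ.chartCore) (f : F) :
    localRep e x₀ z (χ.frameSection hχ f) = f := by
  change e.continuousLinearMapAt ℝ _ (χ _ • e.symmL ℝ _ f) = f
  rw [eq_one_of_mem_chartCore hz, one_smul]
  exact e.continuousLinearMapAt_symmL (χ.chartCore_subset hχ hz).2 f

theorem frameSection_localRep_apply {z : E} (hz : z ∈ χ.chartCore) (σ : Cₛ^∞⟮𝓘(ℝ, E); F, V⟯) :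
    χ.frameSection hχ (localRep e x₀ z σ) ((extChartAt 𝓘(ℝ, E) x₀).symm z) =
      σ ((extChartAt 𝓘(ℝ, E) x₀).symm z) := by
  rw [frameSection_apply, eq_one_of_mem_chartCore hz, one_smul]
  exact e.symmL_continuousLinearMapAt (χ.chartCore_subset hχ hz).2 _

variable [FiniteDimensional ℝ F]

theorem sum_directionalDeriv_sectionCoeff {ι : Type*} [Fintype ι] (B : Module.Basis ι ℝ F)
    {y : M} {z : E} (hz : z ∈ χ.chartCore) (hy : (extChartAt 𝓘(ℝ, E) x₀).symm z = y)
    (σ : Cₛ^∞⟮𝓘(ℝ, E); F, V⟯) (X : TangentSpace 𝓘(ℝ, E) y) :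
    ∑ i, directionalDeriv (χ.sectionCoeff hχ (LinearMap.toContinuousLinearMap (B.coord i)) σ) y X •
        B i =
      fderiv ℝ (fun z => localRep e x₀ z σ) z
        (mfderiv 𝓘(ℝ, E) 𝓘(ℝ, E) (extChartAt 𝓘(ℝ, E) x₀) y X) := by
  set ψ := extChartAt 𝓘(ℝ, E) x₀ with hψ
  have hys : y ∈ ψ.source := hy ▸ ψ.map_target hz.1
  have hψy : ψ y = z := hy ▸ ψ.right_inv hz.1
  refine (Finset.sum_congr rfl fun i _ => ?_).trans (B.sum_repr _)
  congr 1
  set ℓ : F →L[ℝ] ℝ := LinearMap.toContinuousLinearMap (B.coord i) with hℓ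
  have hrep : DifferentiableAt ℝ (fun z => localRep e x₀ z σ) (ψ y) := by
    rw [hψy]
    exact ((χ.contDiffOn_localRep hχ σ).contDiffAt
      (χ.isOpen_chartCore.mem_nhds hz)).differentiableAt (by simp)
  have heq : (χ.sectionCoeff hχ ℓ σ : M → ℝ) =ᶠ[𝓝 y]
      (fun z => ℓ (localRep e x₀ z σ)) ∘ ψ := by
    have hone := eventuallyEq_one_of_mem_chartCore hz
    rw [← hψ, hy] at hone
    filter_upwards [hone, (isOpen_extChartAt_source x₀).mem_nhds hys] with p hp hps
    have h1 : (extChartAt 𝓘(ℝ, E) x₀).symm (ψ p) = p := ψ.left_inv hps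
    change χ p * ℓ (e.continuousLinearMapAt ℝ p (σ p)) =
      ℓ (e.continuousLinearMapAt ℝ ((extChartAt 𝓘(ℝ, E) x₀).symm (ψ p)) _)
    rw [hp, Pi.one_apply, one_mul, h1]
  have hℓrep : HasFDerivAt (fun z => ℓ (localRep e x₀ z σ))
      (ℓ.comp (fderiv ℝ (fun z => localRep e x₀ z σ) (ψ y))) (ψ y) :=
    ℓ.hasFDerivAt.comp (ψ y) hrep.hasFDerivAt
  have hψd : MDifferentiableAt 𝓘(ℝ, E) 𝓘(ℝ, E) ψ y :=
    mdifferentiableAt_extChartAt (by rwa [← extChartAt_source 𝓘(ℝ, E)])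
  rw [directionalDeriv, heq.mfderiv_eq,
    mfderiv_comp y hℓrep.differentiableAt.mdifferentiableAt hψd, mfderiv_eq_fderiv, hℓrep.fderiv,
    ← hψy]
  rfl

/-- The operation on the model fibre given by a bilinear operation on sections. -/
def chartOperation (N : Cₛ^∞⟮𝓘(ℝ, E); F, V⟯ →ₗ[ℝ] Cₛ^∞⟮𝓘(ℝ, E); F, V⟯ →ₗ[ℝ]
    Cₛ^∞⟮𝓘(ℝ, E); F, V⟯) (z : E) : BilinearOperation F :=
  .ofLinearMap ((N.compl₁₂ (χ.frameSection hχ) (χ.frameSection hχ)).compr₂ (localRep e x₀ z))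

variable (N : Cₛ^∞⟮𝓘(ℝ, E); F, V⟯ →ₗ[ℝ] Cₛ^∞⟮𝓘(ℝ, E); F, V⟯ →ₗ[ℝ] Cₛ^∞⟮𝓘(ℝ, E); F, V⟯)

theorem chartOperation_apply (z : E) (u v : F) :
    χ.chartOperation hχ N z u v =
      localRep e x₀ z (N (χ.frameSection hχ u) (χ.frameSection hχ v)) := by
  rw [chartOperation, BilinearOperation.ofLinearMap_apply]
  rfl

theorem contDiffOn_chartOperation : ContDiffOn ℝ ∞ (χ.chartOperation hχ N) χ.chartCore := by
  refine BilinearOperation.contDiffOn_iff.2 fun u v => ?_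
  simp only [chartOperation_apply]
  exact χ.contDiffOn_localRep hχ _

/-- The anchor in the chart and the trivialization. -/
def chartAnchor (A : LieAlgebroid E F V) (z : E) : F →L[ℝ] E :=
  LinearMap.toContinuousLinearMap
    { toFun := fun f => (trivializationAt E (TangentSpace 𝓘(ℝ, E)) x₀).continuousLinearMapAt ℝ
        ((extChartAt 𝓘(ℝ, E) x₀).symm z) (A.anchor _ (χ.frameSection hχ f _))
      map_add' := fun f g => by
        rw [map_add, ContMDiffSection.coe_add, Pi.add_apply, map_add, map_add]
      map_smul' := fun c f => by
        rw [map_smul, ContMDiffSection.coe_smul, Pi.smul_apply, map_smul, map_smul]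
        rfl }

theorem chartAnchor_apply (A : LieAlgebroid E F V) {z : E} (hz : z ∈ χ.chartCore) (f : F) :
    χ.chartAnchor hχ A z f =
      mfderiv 𝓘(ℝ, E) 𝓘(ℝ, E) (extChartAt 𝓘(ℝ, E) x₀) ((extChartAt 𝓘(ℝ, E) x₀).symm z)
        (A.anchor _ (χ.frameSection hχ f ((extChartAt 𝓘(ℝ, E) x₀).symm z))) := by
  have h : (extChartAt 𝓘(ℝ, E) x₀).symm z ∈ (chartAt E x₀).source := by
    rw [← extChartAt_source 𝓘(ℝ, E)]
    exact (extChartAt 𝓘(ℝ, E) x₀).map_target hz.1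
  rw [← TangentBundle.continuousLinearMapAt_trivializationAt h]
  rfl

theorem contDiffOn_chartAnchor (A : LieAlgebroid E F V) :
    ContDiffOn ℝ ∞ (χ.chartAnchor hχ A) χ.chartCore := by
  refine contDiffOn_clm_apply.2 fun f => ?_
  refine ((trivializationAt E (TangentSpace 𝓘(ℝ, E)) x₀).contDiffOn_extChartAt_symm x₀
    (A.contMDiff_anchor.comp (χ.frameSection hχ f).contMDiff)).mono fun z hz => ⟨hz.1, ?_⟩
  rw [mem_preimage, TangentBundle.trivializationAt_baseSet, ← extChartAt_source 𝓘(ℝ, E)]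
  exact (extChartAt 𝓘(ℝ, E) x₀).map_target hz.1

theorem chartAnchor_surjective {A : LieAlgebroid E F V} (hA : A.IsTransitive) {z : E}
    (hz : z ∈ χ.chartCore) : Function.Surjective (χ.chartAnchor hχ A z) := by
  intro v
  set y := (extChartAt 𝓘(ℝ, E) x₀).symm z with hy
  have h : y ∈ (trivializationAt E (TangentSpace 𝓘(ℝ, E)) x₀).baseSet := by
    rw [TangentBundle.trivializationAt_baseSet, ← extChartAt_source 𝓘(ℝ, E)]
    exact (extChartAt 𝓘(ℝ, E) x₀).map_target hz.1
  obtain ⟨a, ha⟩ := hA y ((trivializationAt E (TangentSpace 𝓘(ℝ, E)) x₀).symmL ℝ y v)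
  refine ⟨e.continuousLinearMapAt ℝ y a, ?_⟩
  have h1 : χ.frameSection hχ (e.continuousLinearMapAt ℝ y a) y = a := by
    rw [frameSection_apply, eq_one_of_mem_chartCore hz, one_smul]
    exact e.symmL_continuousLinearMapAt (χ.chartCore_subset hχ hz).2 _
  change (trivializationAt E (TangentSpace 𝓘(ℝ, E)) x₀).continuousLinearMapAt ℝ y
    (A.anchor y (χ.frameSection hχ (e.continuousLinearMapAt ℝ y a) y)) = v
  rw [h1, ha]
  exact (trivializationAt E (TangentSpace 𝓘(ℝ, E)) x₀).continuousLinearMapAt_symmL h v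

end SmoothBumpFunction

namespace LieAlgebroid.SelfConnection

variable {E : Type*} [NormedAddCommGroup E] [NormedSpace ℝ E] [FiniteDimensional ℝ E]
  {M : Type*} [TopologicalSpace M] [T2Space M] [ChartedSpace E M] [IsManifold 𝓘(ℝ, E) ∞ M]
  {F : Type*} [NormedAddCommGroup F] [NormedSpace ℝ F] [FiniteDimensional ℝ F]
  {V : M → Type*} [TopologicalSpace (TotalSpace F V)] [∀ x, TopologicalSpace (V x)]
  [∀ x, AddCommGroup (V x)] [∀ x, Module ℝ (V x)] [FiberBundle F V] [VectorBundle ℝ F V]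
  [ContMDiffVectorBundle ∞ F V 𝓘(ℝ, E)] {A : LieAlgebroid E F V} (C : A.SelfConnection)

open ContMDiffSection

/-- The bracket `{σ, τ}` as a bilinear map. -/
def symBracketLinear :
    Cₛ^∞⟮𝓘(ℝ, E); F, V⟯ →ₗ[ℝ] Cₛ^∞⟮𝓘(ℝ, E); F, V⟯ →ₗ[ℝ] Cₛ^∞⟮𝓘(ℝ, E); F, V⟯ :=
  C.D.flip - C.D + A.bracket

omit [FiniteDimensional ℝ E] [T2Space M] [FiniteDimensional ℝ F]
  [ContMDiffVectorBundle ∞ F V 𝓘(ℝ, E)] in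
theorem symBracketLinear_apply (σ τ : Cₛ^∞⟮𝓘(ℝ, E); F, V⟯) :
    C.symBracketLinear σ τ = C.symBracket σ τ :=
  (C.symBracket_eq σ τ).symm

variable {x₀ : M} {χ : SmoothBumpFunction 𝓘(ℝ, E) x₀}
  {e : Trivialization F (TotalSpace.proj : TotalSpace F V → M)} [MemTrivializationAtlas e]
  (hχ : tsupport χ ⊆ e.baseSet)

theorem localRep_symBracket {z : E} (hz : z ∈ χ.chartCore) (σ τ : Cₛ^∞⟮𝓘(ℝ, E); F, V⟯) :
    localRep e x₀ z (C.symBracket σ τ) =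
      χ.chartOperation hχ C.symBracketLinear z (localRep e x₀ z σ) (localRep e x₀ z τ) := by
  rw [χ.chartOperation_apply, symBracketLinear_apply]
  exact congrArg (e.continuousLinearMapAt ℝ _) (C.symBracket_apply_eq
    (χ.frameSection_localRep_apply hχ hz σ).symm (χ.frameSection_localRep_apply hχ hz τ).symm)

theorem localRep_D {z : E} (hz : z ∈ χ.chartCore) (f : F) (τ : Cₛ^∞⟮𝓘(ℝ, E); F, V⟯) :
    localRep e x₀ z (C.D (χ.frameSection hχ f) τ) =
      χ.chartOperation hχ C.D z f (localRep e x₀ z τ) +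
        fderiv ℝ (fun z => localRep e x₀ z τ) z (χ.chartAnchor hχ A z f) := by
  set y := (extChartAt 𝓘(ℝ, E) x₀).symm z with hy
  set B := Module.finBasis ℝ F
  have h1 := C.D_apply_eq_sum χ hχ B (χ.frameSection hχ f) τ
    (SmoothBumpFunction.eventuallyEq_one_of_mem_chartCore hz)
  have h2 := congrArg (e.continuousLinearMapAt ℝ y) h1
  refine h2.trans ?_
  rw [χ.chartAnchor_apply hχ A hz, ← χ.sum_directionalDeriv_sectionCoeff hχ B hz rfl, map_sum]
  simp only [map_add, Finset.sum_add_distrib]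
  congr 1
  · have h3 : χ.chartOperation hχ C.D z f (localRep e x₀ z τ) =
        ∑ i, B.repr (localRep e x₀ z τ) i • χ.chartOperation hχ C.D z f (B i) := by
      rw [χ.chartOperation_apply]
      conv_lhs => rw [← B.sum_repr (localRep e x₀ z τ)]
      simp only [map_sum, map_smul, χ.chartOperation_apply]
    rw [h3]
    refine Finset.sum_congr rfl fun i _ => ?_
    rw [map_smul, χ.chartOperation_apply]
    rfl
  · refine Finset.sum_congr rfl fun i _ => ?_
    rw [map_smul]
    exact congrArg _ (χ.localRep_frameSection hχ hz (B i))

variable {C}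

theorem IsLocallySymmetric.fderiv_chartOperation (h : C.IsLocallySymmetric) {z : E}
    (hz : z ∈ χ.chartCore) (f : F) :
    fderiv ℝ (χ.chartOperation hχ C.symBracketLinear) z (χ.chartAnchor hχ A z f) =
      (χ.chartOperation hχ C.symBracketLinear z).infinitesimalAction
        (-(χ.chartOperation hχ C.D z).toCLM f) := by
  set b := χ.chartOperation hχ C.symBracketLinear with hb
  set Γ := χ.chartOperation hχ C.D with hΓ
  have hΓ' : ∀ w, (Γ z).toCLM f w = Γ z f w := fun w => (Γ z).toCLM_apply f w
  ext u v
  have hd : HasDerivAt (fun t : ℝ => b (z + t • χ.chartAnchor hχ A z f))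
      (fderiv ℝ b z (χ.chartAnchor hχ A z f)) 0 := by
    have h1 : DifferentiableAt ℝ b z := ((χ.contDiffOn_chartOperation hχ _).contDiffAt
      (χ.isOpen_chartCore.mem_nhds hz)).differentiableAt (by simp)
    exact h1.hasFDerivAt.hasLineDerivAt _
  have hd1 : fderiv ℝ (fun z => b z u v) z (χ.chartAnchor hχ A z f) =
      fderiv ℝ b z (χ.chartAnchor hχ A z f) u v := by
    have h1 : DifferentiableAt ℝ (fun z => b z u v) z :=
      ((BilinearOperation.contDiffOn_iff.1 (χ.contDiffOn_chartOperation hχ _) u v).contDiffAt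
        (χ.isOpen_chartCore.mem_nhds hz)).differentiableAt (by simp)
    exact (h1.hasFDerivAt.hasLineDerivAt _).unique (hd.bilinearOperation_apply_const u v)
  rw [← hd1, BilinearOperation.infinitesimalAction_apply]
  simp only [neg_apply, hΓ']
  have e1 := C.localRep_D hχ hz f (C.symBracket (χ.frameSection hχ u) (χ.frameSection hχ v))
  rw [h.D_symBracket, map_add, C.localRep_symBracket hχ hz, C.localRep_symBracket hχ hz,
    C.localRep_symBracket hχ hz, χ.localRep_frameSection hχ hz, χ.localRep_frameSection hχ hz,
    ← χ.chartOperation_apply, ← χ.chartOperation_apply, ← hb, ← hΓ] at e1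
  have e2 : (fun z => localRep e x₀ z
      (C.symBracket (χ.frameSection hχ u) (χ.frameSection hχ v))) = fun z => b z u v := by
    funext z
    rw [hb, χ.chartOperation_apply, symBracketLinear_apply]
  rw [e2] at e1
  have e3 : ∀ w, b z (-Γ z f u) w = -b z (Γ z f u) w := fun w => by
    simpa using (b z).map_smul_left (Γ z f u) w (-1)
  have e4 : ∀ w, b z w (-Γ z f v) = -b z w (Γ z f v) := fun w => by
    simpa using (b z).map_smul_right w (Γ z f v) (-1)
  rw [e3, e4, ← sub_eq_zero]
  rw [← sub_eq_zero] at e1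
  rw [← neg_eq_zero, ← e1]
  abel

end LieAlgebroid.SelfConnection

theorem ContinuousOn.exists_rightInverse {E F : Type*} [NormedAddCommGroup E] [NormedSpace ℝ E]
    [FiniteDimensional ℝ E] [NormedAddCommGroup F] [NormedSpace ℝ F] [FiniteDimensional ℝ F]
    {a : E → (F →L[ℝ] E)} {O : Set E} {z₀ : E} (hO : O ∈ 𝓝 z₀) (ha : ContinuousOn a O)
    (hs : Function.Surjective (a z₀)) :
    ∃ (O' : Set E) (ρ : E → (E →L[ℝ] F)), O' ⊆ O ∧ O' ∈ 𝓝 z₀ ∧ ContinuousOn ρ O' ∧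
      ∀ z ∈ O', ∀ v, a z (ρ z v) = v := by
  obtain ⟨r₀, hr₀⟩ := (a z₀).toLinearMap.exists_rightInverse_of_surjective
    (LinearMap.range_eq_top.2 hs)
  set r : E →L[ℝ] F := LinearMap.toContinuousLinearMap r₀ with hr
  have hc : ContinuousOn (fun z => (a z).comp r) O := ha.clm_comp continuousOn_const
  refine ⟨O ∩ {z | IsUnit ((a z).comp r)}, fun z => r.comp (Ring.inverse ((a z).comp r)),
    inter_subset_left, inter_mem hO ?_, ?_, ?_⟩
  · refine (hc.continuousAt hO).eventually_mem (Units.isOpen.mem_nhds ?_)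
    have : (a z₀).comp r = 1 := by
      ext v
      exact congr($hr₀ v)
    rw [mem_ofPred_eq, this]
    exact isUnit_one
  · refine continuousOn_const.clm_comp fun z hz => ?_
    obtain ⟨u, hu⟩ := hz.2
    have h := NormedRing.inverse_continuousAt u
    rw [hu] at h
    exact ContinuousAt.comp_continuousWithinAt (f := fun z => (a z).comp r) h
      ((hc z hz.1).mono inter_subset_left)
  · intro z hz v
    exact congr($(Ring.mul_inverse_cancel _ hz.2) v)

namespace LieAlgebroid.SelfConnection

variable {E : Type*} [NormedAddCommGroup E] [NormedSpace ℝ E] [FiniteDimensional ℝ E]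
  {M : Type*} [TopologicalSpace M] [T2Space M] [ChartedSpace E M] [IsManifold 𝓘(ℝ, E) ∞ M]
  {F : Type*} [NormedAddCommGroup F] [NormedSpace ℝ F] [FiniteDimensional ℝ F]
  {V : M → Type*} [TopologicalSpace (TotalSpace F V)] [∀ x, TopologicalSpace (V x)]
  [∀ x, AddCommGroup (V x)] [∀ x, Module ℝ (V x)] [FiberBundle F V] [VectorBundle ℝ F V]
  [ContMDiffVectorBundle ∞ F V 𝓘(ℝ, E)] {A : LieAlgebroid E F V} {C : A.SelfConnection}

open ContMDiffSection

theorem IsLocallySymmetric.exists_intertwining (hsym : C.IsLocallySymmetric)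
    (hA : A.IsTransitive) (x₀ : M)
    (e : Trivialization F (TotalSpace.proj : TotalSpace F V → M)) [MemTrivializationAtlas e]
    (hx₀ : x₀ ∈ e.baseSet) :
    ∃ (U : Set M) (g : M → (F →L[ℝ] F)) (b : F → F → F), IsOpen U ∧ x₀ ∈ U ∧ U ⊆ e.baseSet ∧
      ContMDiffOn 𝓘(ℝ, E) 𝓘(ℝ, F →L[ℝ] F) ∞ g U ∧ ∀ y ∈ U, IsUnit (g y) ∧
        ∀ σ τ : Cₛ^∞⟮𝓘(ℝ, E); F, V⟯,
          g y (e.continuousLinearMapAt ℝ y (C.symBracket σ τ y)) =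
            b (g y (e.continuousLinearMapAt ℝ y (σ y)))
              (g y (e.continuousLinearMapAt ℝ y (τ y))) := by
  obtain ⟨χ, hχ, -⟩ := (SmoothBumpFunction.nhds_basis_support (I := 𝓘(ℝ, E)) (c := x₀)
    (e.open_baseSet.mem_nhds hx₀)).mem_iff.1 univ_mem
  set ψ := extChartAt 𝓘(ℝ, E) x₀ with hψ
  set β := χ.chartOperation hχ C.symBracketLinear with hβ
  have hcore := χ.isOpen_chartCore.mem_nhds χ.mem_chartCore
  obtain ⟨O, ρ, hO, hOn, hρ, hinv⟩ := ContinuousOn.exists_rightInverse hcore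
    (χ.contDiffOn_chartAnchor hχ A).continuousOn
    (χ.chartAnchor_surjective hχ hA χ.mem_chartCore)
  have hΓ : ContinuousOn (fun z => (χ.chartOperation hχ C.D z).toCLM) O :=
    (χ.contDiffOn_chartOperation hχ C.D).continuousOn.mono hO
  obtain ⟨r, hr, hball, g, hg, hgu⟩ := BilinearOperation.exists_intertwining hOn
    ((χ.contDiffOn_chartOperation hχ C.symBracketLinear).mono hO)
    (fun z v => -(χ.chartOperation hχ C.D z).toCLM (ρ z v))
    (fun v => (hΓ.clm_apply (hρ.clm_apply continuousOn_const)).neg)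
    (fun z hz v => by
      have := hsym.fderiv_chartOperation hχ (hO hz) (ρ z v)
      rwa [hinv z hz] at this)
  have hUs : ψ.source ∩ ψ ⁻¹' Metric.ball (ψ x₀) r ⊆ e.baseSet := fun y hy => by
    have := (χ.chartCore_subset hχ (hO (hball hy.2))).2
    rwa [mem_preimage, ψ.left_inv hy.1] at this
  refine ⟨ψ.source ∩ ψ ⁻¹' Metric.ball (ψ x₀) r, g ∘ ψ, β (ψ x₀),
    isOpen_extChartAt_preimage' x₀ Metric.isOpen_ball,
    ⟨mem_extChartAt_source x₀, Metric.mem_ball_self hr⟩, hUs, ?_, fun y hy => ?_⟩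
  · refine hg.contMDiffOn.comp ?_ fun y hy => hy.2
    refine contMDiffOn_extChartAt.mono fun y hy => ?_
    rw [← extChartAt_source 𝓘(ℝ, E)]
    exact hy.1
  · refine ⟨(hgu _ hy.2).1, fun σ τ => ?_⟩
    have h1 := C.localRep_symBracket hχ (hO (hball hy.2)) σ τ
    have h2 := (hgu _ hy.2).2 (localRep e x₀ (ψ y) σ) (localRep e x₀ (ψ y) τ)
    rw [← h1] at h2
    have h3 : ∀ σ : Cₛ^∞⟮𝓘(ℝ, E); F, V⟯,
        localRep e x₀ (ψ y) σ = e.continuousLinearMapAt ℝ y (σ y) := fun σ => by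
      change e.continuousLinearMapAt ℝ (ψ.symm (ψ y)) (σ (ψ.symm (ψ y))) = _
      rw [ψ.left_inv hy.1]
    rwa [h3, h3, h3] at h2

end LieAlgebroid.SelfConnection

theorem IsLieAlgebraicBracket.of_linearEquiv {R N N' : Type*} [CommRing R] [AddCommGroup N]
    [Module R N] [AddCommGroup N'] [Module R N'] {b : N → N → N} {b' : N' → N' → N'}
    (h : IsLieAlgebraicBracket R b) (φ : N ≃ₗ[R] N') (hφ : ∀ x y, φ (b x y) = b' (φ x) (φ y)) :
    IsLieAlgebraicBracket R b' := by
  have hb : b' = fun x y => φ (b (φ.symm x) (φ.symm y)) := by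
    ext x y
    rw [hφ, φ.apply_symm_apply, φ.apply_symm_apply]
  subst hb
  constructor
  · intro x y z
    simp only [map_add, h.add_left]
  · intro x y z
    simp only [map_add, h.add_right]
  · intro r x y
    simp only [map_smul, h.smul_left]
  · intro r x y
    simp only [map_smul, h.smul_right]
  · intro x
    simp only [h.self, map_zero]
  · intro x y z
    simp only [LinearEquiv.symm_apply_apply, ← map_add, h.jacobi, map_zero]

section LocalTrivializations

variable {E : Type*} [NormedAddCommGroup E] [NormedSpace ℝ E]
  {M : Type*} [TopologicalSpace M] [ChartedSpace E M]
  {F : Type*} [NormedAddCommGroup F] [NormedSpace ℝ F]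
  {V : M → Type*} [TopologicalSpace (TotalSpace F V)] [∀ x, TopologicalSpace (V x)]
  [∀ x, AddCommGroup (V x)] [∀ x, Module ℝ (V x)] [FiberBundle F V] [VectorBundle ℝ F V]

/-- A trivialization corrected by a smooth family of automorphisms of the model fibre is a smooth
local trivialization. -/
theorem Bundle.Trivialization.exists_twist [ContMDiffVectorBundle ∞ F V 𝓘(ℝ, E)] [CompleteSpace F]
    (e : Trivialization F (TotalSpace.proj : TotalSpace F V → M)) [MemTrivializationAtlas e]
    {U : Set M} (hU : U ⊆ e.baseSet) {g : M → (F →L[ℝ] F)}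
    (hg : ContMDiffOn 𝓘(ℝ, E) 𝓘(ℝ, F →L[ℝ] F) ∞ g U) (hu : ∀ y ∈ U, IsUnit (g y)) :
    ∃ φ : ∀ y : M, V y ≃ₗ[ℝ] F,
      ContMDiffOn (𝓘(ℝ, E).prod 𝓘(ℝ, F)) 𝓘(ℝ, F) ∞
        (fun p : TotalSpace F V => φ p.1 p.2) (TotalSpace.proj ⁻¹' U) ∧
      ContMDiffOn (𝓘(ℝ, E).prod 𝓘(ℝ, F)) (𝓘(ℝ, E).prod 𝓘(ℝ, F)) ∞
        (fun q : M × F => (⟨q.1, (φ q.1).symm q.2⟩ : TotalSpace F V)) (U ×ˢ univ) ∧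
      ∀ y ∈ U, ∀ v : V y, φ y v = g y (e.continuousLinearMapAt ℝ y v) := by
  classical
  have hginv : ContMDiffOn 𝓘(ℝ, E) 𝓘(ℝ, F →L[ℝ] F) ∞ (fun y => Ring.inverse (g y)) U := by
    intro y hy
    obtain ⟨u, hu⟩ := hu y hy
    have h := contDiffAt_ringInverse ℝ (n := ∞) u
    rw [hu] at h
    exact ContMDiffAt.comp_contMDiffWithinAt (f := g) y h.contMDiffAt (hg y hy)
  have hex : ∀ y, ∃ φ : V y ≃ₗ[ℝ] F, y ∈ U →
      (∀ v, φ v = g y (e.continuousLinearMapAt ℝ y v)) ∧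
      ∀ f, φ.symm f = e.symmL ℝ y (Ring.inverse (g y) f) := by
    intro y
    by_cases hy : y ∈ U
    · have h1 : ∀ f, g y (Ring.inverse (g y) f) = f := fun f =>
        congr($(Ring.mul_inverse_cancel _ (hu y hy)) f)
      have h2 : ∀ f, Ring.inverse (g y) (g y f) = f := fun f =>
        congr($(Ring.inverse_mul_cancel _ (hu y hy)) f)
      refine ⟨LinearEquiv.ofLinearMap
        ((g y).toLinearMap ∘ₗ (e.continuousLinearMapAt ℝ y).toLinearMap)
        ((e.symmL ℝ y).toLinearMap ∘ₗ (Ring.inverse (g y)).toLinearMap) ?_ ?_, fun _ =>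
        ⟨fun _ => rfl, fun _ => rfl⟩⟩
      · ext f
        change g y (e.continuousLinearMapAt ℝ y (e.symmL ℝ y (Ring.inverse (g y) f))) = f
        rw [e.continuousLinearMapAt_symmL (hU hy), h1]
      · ext v
        change e.symmL ℝ y (Ring.inverse (g y) (g y (e.continuousLinearMapAt ℝ y v))) = v
        rw [h2, e.symmL_continuousLinearMapAt (hU hy)]
    · exact ⟨(trivializationAt F V y).linearEquivAt ℝ y (mem_baseSet_trivializationAt F V y),
        fun h => absurd h hy⟩
  choose φ hφ using hex
  refine ⟨φ, ?_, ?_, fun y hy => (hφ y hy).1⟩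
  · have h1 : ContMDiffOn (𝓘(ℝ, E).prod 𝓘(ℝ, F)) 𝓘(ℝ, F →L[ℝ] F) ∞
        (fun p : TotalSpace F V => g p.1) (TotalSpace.proj ⁻¹' U) :=
      hg.comp (contMDiff_proj V).contMDiffOn fun _ h => h
    have h2 : ContMDiffOn (𝓘(ℝ, E).prod 𝓘(ℝ, F)) 𝓘(ℝ, F) ∞
        (fun p : TotalSpace F V => (e p).2) (TotalSpace.proj ⁻¹' U) :=
      contMDiff_snd.comp_contMDiffOn
        (e.contMDiffOn.mono fun p hp => e.mem_source.2 (hU hp))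
    refine (h1.clm_apply h2).congr fun p hp => ?_
    rw [(hφ p.1 hp).1, e.continuousLinearMapAt_apply_of_mem ℝ (hU hp)]
  · have h1 : ContMDiffOn (𝓘(ℝ, E).prod 𝓘(ℝ, F)) 𝓘(ℝ, F →L[ℝ] F) ∞
        (fun q : M × F => Ring.inverse (g q.1)) (U ×ˢ univ) :=
      hginv.comp contMDiff_fst.contMDiffOn fun _ h => h.1
    have h2 : ContMDiffOn (𝓘(ℝ, E).prod 𝓘(ℝ, F)) (𝓘(ℝ, E).prod 𝓘(ℝ, F)) ∞
        (fun q : M × F => (q.1, Ring.inverse (g q.1) q.2)) (U ×ˢ univ) :=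
      contMDiffOn_fst.prodMk (h1.clm_apply contMDiffOn_snd)
    refine (e.contMDiffOn_symm.comp h2 fun q hq => e.mem_target.2 (hU hq.1)).congr fun q hq => ?_
    rw [(hφ q.1 hq.1).2]
    rw [e.symmL_apply (hU hq.1)]
    exact e.mk_symm (hU hq.1) _

/-- `b` is the model of the fibrewise operation `br` near `x`. -/
def IsLocalModel (E F : Type*) [NormedAddCommGroup E] [NormedSpace ℝ E]
    {M : Type*} [TopologicalSpace M] [ChartedSpace E M] [NormedAddCommGroup F] [NormedSpace ℝ F]
    (V : M → Type*) [TopologicalSpace (TotalSpace F V)] [∀ x, TopologicalSpace (V x)]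
    [∀ x, AddCommGroup (V x)] [∀ x, Module ℝ (V x)] [FiberBundle F V] [VectorBundle ℝ F V]
    (br : ∀ x : M, V x → V x → V x) (b : F → F → F) (x : M) : Prop :=
  ∃ (U : Set M) (φ : ∀ y : M, V y ≃ₗ[ℝ] F), IsOpen U ∧ x ∈ U ∧
    ContMDiffOn (𝓘(ℝ, E).prod 𝓘(ℝ, F)) 𝓘(ℝ, F) ∞
      (fun p : TotalSpace F V => φ p.1 p.2) (TotalSpace.proj ⁻¹' U) ∧
    ContMDiffOn (𝓘(ℝ, E).prod 𝓘(ℝ, F)) (𝓘(ℝ, E).prod 𝓘(ℝ, F)) ∞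
      (fun q : M × F => (⟨q.1, (φ q.1).symm q.2⟩ : TotalSpace F V)) (U ×ˢ Set.univ) ∧
    ∀ y ∈ U, ∀ v w : V y, φ y (br y v w) = b (φ y v) (φ y w)

theorem IsLocalModel.of_linearEquiv [FiniteDimensional ℝ F] {br : ∀ x : M, V x → V x → V x}
    {b b' : F → F → F} {x : M}
    (h : IsLocalModel E F V br b x) (ψ : F ≃ₗ[ℝ] F) (hψ : ∀ u v, ψ (b u v) = b' (ψ u) (ψ v)) :
    IsLocalModel E F V br b' x := by
  obtain ⟨U, φ, hU, hx, h1, h2, h3⟩ := h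
  have hs : ∀ χ : F ≃ₗ[ℝ] F, ContDiff ℝ ∞ χ := fun χ =>
    (LinearMap.toContinuousLinearMap χ.toLinearMap).contDiff
  refine ⟨U, fun y => (φ y).trans ψ, hU, hx, ?_, ?_, fun y hy v w => ?_⟩
  · exact (hs ψ).contMDiff.comp_contMDiffOn h1
  · exact h2.comp (contMDiffOn_fst.prodMk ((hs ψ.symm).contMDiff.comp_contMDiffOn contMDiffOn_snd))
      fun q hq => ⟨hq.1, trivial⟩
  · change ψ (φ y (br y v w)) = b' (ψ (φ y v)) (ψ (φ y w))
    rw [h3 y hy, hψ]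

/-- A fibrewise Lie bracket with local models is a Lie algebra bundle: the model can be chosen to be
constant on connected components. -/
theorem IsLieAlgebraBundle.of_isLocalModel [FiniteDimensional ℝ F]
    {br : ∀ x : M, V x → V x → V x}
    (hbr : ∀ x, IsLieAlgebraicBracket ℝ (br x)) (h : ∀ x, ∃ b, IsLocalModel E F V br b x) :
    IsLieAlgebraBundle E F V br := by
  refine ⟨hbr, fun x₀ => ?_⟩
  obtain ⟨b, hb⟩ := h x₀
  refine ⟨b, ?_, ?_⟩
  · obtain ⟨U, φ, hU, hx, -, -, h3⟩ := hb
    exact (hbr x₀).of_linearEquiv (φ x₀) (h3 x₀ hx)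
  have hmono : ∀ {b x}, IsLocalModel E F V br b x → ∀ᶠ y in 𝓝 x, IsLocalModel E F V br b y := by
    rintro b x ⟨U, φ, hU, hx, h'⟩
    filter_upwards [hU.mem_nhds hx] with y hy
    exact ⟨U, φ, hU, hy, h'⟩
  have htrans : ∀ {b b' : F → F → F} {x}, IsLocalModel E F V br b x →
      IsLocalModel E F V br b' x → ∀ {y}, IsLocalModel E F V br b y →
      IsLocalModel E F V br b' y := by
    rintro b b' x ⟨U, φ, hU, hx, -, -, h3⟩ ⟨U', φ', hU', hx', -, -, h3'⟩ y hy
    refine hy.of_linearEquiv ((φ x).symm.trans (φ' x)) fun u v => ?_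
    obtain ⟨u, rfl⟩ := (φ x).surjective u
    obtain ⟨v, rfl⟩ := (φ x).surjective v
    rw [← h3 x hx]
    simp only [LinearEquiv.trans_apply, LinearEquiv.symm_apply_apply]
    exact h3' x hx' u v
  have hclopen : IsClopen {x | IsLocalModel E F V br b x} := by
    refine ⟨⟨isOpen_iff_mem_nhds.2 fun x hx => ?_⟩, isOpen_iff_mem_nhds.2 fun x hx => hmono hx⟩
    obtain ⟨b', hb'⟩ := h x
    filter_upwards [hmono hb'] with y hy hyb
    exact hx (htrans hy hyb hb')
  intro x hx
  exact hclopen.connectedComponent_subset hb hx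

end LocalTrivializations

end

theorem theorem3
    {E : Type*} [NormedAddCommGroup E] [NormedSpace ℝ E] [FiniteDimensional ℝ E]
    {M : Type*} [TopologicalSpace M] [T2Space M] [ChartedSpace E M] [IsManifold 𝓘(ℝ, E) ∞ M]
    {F : Type*} [NormedAddCommGroup F] [NormedSpace ℝ F] [FiniteDimensional ℝ F]
    {V : M → Type*} [TopologicalSpace (TotalSpace F V)] [∀ x, TopologicalSpace (V x)]
    [∀ x, AddCommGroup (V x)] [∀ x, Module ℝ (V x)] [FiberBundle F V] [VectorBundle ℝ F V]
    [ContMDiffVectorBundle ∞ F V 𝓘(ℝ, E)]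
    (A : LieAlgebroid E F V) (hA : A.IsTransitive)
    (C : A.SelfConnection) (hrep : C.IsRepresentation) (hext : C.ExtendsCanonical)
    (hsym : C.IsLocallySymmetric) :
    -- the bracket `-T` is Lie-algebraic over the smooth functions
    IsLieAlgebraicBracket C^∞⟮𝓘(ℝ, E), M; 𝓘(ℝ, ℝ), ℝ⟯ C.symBracket ∧
    -- it is the bracket of sections of a Lie algebra bundle structure
    (∃ br : ∀ x : M, V x → V x → V x, IsLieAlgebraBundle E F V br ∧
      ∀ (σ τ : Cₛ^∞⟮𝓘(ℝ, E); F, V⟯) (x : M), C.symBracket σ τ x = br x (σ x) (τ x)) ∧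
    -- on the kernel the algebroid bracket is its negative
    (∀ s t : Cₛ^∞⟮𝓘(ℝ, E); F, V⟯, A.IsKernelSection s → A.IsKernelSection t →
      A.bracket s t = -C.symBracket s t) ∧
    -- each `D_ρ` is a derivation
    (∀ ρ σ τ : Cₛ^∞⟮𝓘(ℝ, E); F, V⟯,
      C.D ρ (C.symBracket σ τ) = C.symBracket (C.D ρ σ) τ + C.symBracket σ (C.D ρ τ)) ∧
    -- `D_s` is minus the inner derivation by the kernel section `s`
    (∀ s : Cₛ^∞⟮𝓘(ℝ, E); F, V⟯, A.IsKernelSection s →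
      ∀ τ : Cₛ^∞⟮𝓘(ℝ, E); F, V⟯, C.D s τ = -C.symBracket s τ) := by
  have hLie := LieAlgebroid.SelfConnection.isLieAlgebraicBracket_symBracket hrep hsym
  refine ⟨hLie, ?_, fun s t hs ht => hext.bracket_eq hs ht, hsym.D_symBracket,
    fun s hs τ => hext.D_eq hs τ⟩
  choose s hs using fun x => ContMDiffSection.exists_apply_eq (E := E) (F := F) (V := V) x
  have hbr : ∀ (σ τ : Cₛ^∞⟮𝓘(ℝ, E); F, V⟯) (x : M),
      C.symBracket σ τ x = C.symBracket (s x (σ x)) (s x (τ x)) x := fun σ τ x =>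
    C.symBracket_apply_eq (hs x _).symm (hs x _).symm
  refine ⟨fun x v w => C.symBracket (s x v) (s x w) x,
    IsLieAlgebraBundle.of_isLocalModel (fun x => ?_) (fun x₀ => ?_), hbr⟩
  · constructor
    · intro u v w
      rw [map_add, C.symBracket_add_left]
      rfl
    · intro u v w
      rw [map_add, C.symBracket_add_right]
      rfl
    · intro r v w
      rw [map_smul, ← C.symBracketLinear_apply, map_smul, LinearMap.smul_apply,
        C.symBracketLinear_apply]
      rfl
    · intro r v w
      rw [map_smul, ← C.symBracketLinear_apply, map_smul, C.symBracketLinear_apply]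
      rfl
    · intro v
      rw [C.symBracket_self]
      rfl
    · intro u v w
      have key : ∀ u v w : V x, C.symBracket (s x u) (s x (C.symBracket (s x v) (s x w) x)) x =
          C.symBracket (s x u) (C.symBracket (s x v) (s x w)) x := fun u v w =>
        C.symBracket_apply_eq rfl (hs x _)
      rw [key, key, key]
      exact congr($(hLie.jacobi (s x u) (s x v) (s x w)) x)
  · set e := trivializationAt F V x₀
    obtain ⟨U, g, b, hU, hx, hUe, hg, hgu⟩ := hsym.exists_intertwining hA x₀ e
      (mem_baseSet_trivializationAt F V x₀)
    obtain ⟨φ, h1, h2, h3⟩ := e.exists_twist hUe hg fun y hy => (hgu y hy).1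
    refine ⟨b, U, φ, hU, hx, h1, h2, fun y hy v w => ?_⟩
    rw [h3 y hy, h3 y hy, h3 y hy, (hgu y hy).2, hs, hs]
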